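/- Let $p\in[1,\infty)\setminus 2\mathbb Z$ be real, let $k>\max\{2,p\}$ be an integer, and let $1/2<s\le c<1$ be real. Then there exists $\gamma=\gamma(p,k,s,c)$ with \[ \gamma\;\ge\;1+(c-s)\cdot\frac{|\sin(\pi p/2)|}{4p^3k}\cdot\Big(\frac{2p}{e^2\pi^2k}\Big)^{(p+1)/2} \] and a polynomial-time (Karp) reduction from $(s,c)$-Gap-$k$-Parity to $\gamma$-$\mathrm{CVP}_p$ that maps every instance on $n$ variables to an instance of rank $n$. Here an instance $\Phi$ of $k$-Parity on $n$ Boolean variables is a nonempty list of constraints $x_{i_1}\oplus\cdots\oplus x_{i_k}=b$ with $b\in\{0,1\}$ and not necessarily distinct variables; $\mathrm{val}(\Phi)$ is the maximum, over all assignments in $\{0,1\}^n$, of the fraction of satisfied constraints. In $(s,c)$-Gap-$k$-Parity, $\Phi$ is a YES instance if $\mathrm{val}(\Phi)\ge c$ and a NO instance if $\mathrm{val}(\Phi)<s$. An instance of $\gamma$-$\mathrm{CVP}_p$ of rank $n$ consists of a matrix $B\in\mathbb R^{d\times n}$ with linearly independent columns, a vector $t\in\mathbb R^d$ and a number $r>0$;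 with $\mathcal L$ the lattice of all integer combinations of the columns of $B$, it is a YES instance if $\mathrm{dist}_p(\mathcal L,t)=\min_{x\in\mathcal L}\|x-t\|_p\le r$ and a NO instance if $\mathrm{dist}_p(\mathcal L,t)>\gamma r$. The reduction is computed by a Turing machine in a number of steps polynomial in the length of the encoding of $\Phi$ (which is at least $n$; integers may be written in unary), and maps YES instances to YES instances and NO instances to NO instances. The real numbers in its output are written as arithmetic expressions in natural numbers (in unary) and the fixed parameters $p,s,c$, with the operations $+,-,\cdot,/$ and real powers of positive numbers; the number of operations in each expression is bounded by a constant depending only on $p,k,s,c$. -/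

import Mathlib

noncomputable section

/-! ### Promise problems and polynomial-time Karp reductions -/

/-- A promise problem: a set of YES instances and a set of NO instances. -/
structure PromiseProblem (α : Type) where
  yes : Set α
  no : Set α

/-- `f` is a polynomial-time Karp (many-one) reduction from `P` to `Q`, with instances written as
strings through `ea` and `eb`: a Turing machine computes `f` in polynomially many steps, `f` maps
YES instances to YES instances and NO instances to NO instances. -/
def IsPolyTimeKarpReduction {α β Γ₀ Γ₁ : Type} (ea : α → List Γ₀) (eb : β → List Γ₁)
    (P : PromiseProblem α) (Q : PromiseProblem β) (f : α → β) : Prop :=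
  Nonempty (Turing.TM2ComputableInPolyTime ea eb f) ∧
    (∀ a ∈ P.yes, f a ∈ Q.yes) ∧ (∀ a ∈ P.no, f a ∈ Q.no)

/-! ### Gap-`k`-Parity -/

/-- A constraint `y (var 0) ⊕ ⋯ ⊕ y (var (k-1)) = rhs` on `n` Boolean variables; the `k` variables
need not be distinct. The set `{0, 1}` with `⊕` is `ZMod 2` with `+`. -/
structure ParityConstraint (k n : ℕ) where
  var : Fin k → Fin n
  rhs : ZMod 2

/-- An assignment satisfies a parity constraint. -/
def ParityConstraint.Sat {k n : ℕ} (C : ParityConstraint k n) (y : Fin n → ZMod 2) : Prop :=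
  ∑ j, y (C.var j) = C.rhs

instance {k n : ℕ} (C : ParityConstraint k n) (y : Fin n → ZMod 2) : Decidable (C.Sat y) :=
  inferInstanceAs (Decidable (∑ j, y (C.var j) = C.rhs))

/-- An instance of `k`-Parity: a number of variables and a nonempty list of constraints. -/
structure ParityInstance (k : ℕ) where
  numVars : ℕ
  constraints : List (ParityConstraint k numVars)
  nonempty : constraints ≠ []

/-- `m⁺(y)`, the number of constraints satisfied by `y`. -/
def ParityInstance.numSat {k : ℕ} (Φ : ParityInstance k) (y : Fin Φ.numVars → ZMod 2) : ℕ :=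
  Φ.constraints.countP fun C => C.Sat y

/-- `val(Φ)`, the maximum over all (finitely many) assignments of the fraction of satisfied
constraints. -/
def ParityInstance.val {k : ℕ} (Φ : ParityInstance k) : ℝ :=
  ⨆ y : Fin Φ.numVars → ZMod 2, (Φ.numSat y : ℝ) / (Φ.constraints.length : ℝ)

/-- `(s, c)`-Gap-`k`-Parity. -/
def GapParity (k : ℕ) (s c : ℝ) : PromiseProblem (ParityInstance k) where
  yes := {Φ | c ≤ Φ.val}
  no := {Φ | Φ.val < s}

/-- The alphabet for `k`-Parity instances. -/
inductive ParitySymbol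
  | tick
  | close
  | zero
  | one
  deriving DecidableEq

instance : Fintype ParitySymbol :=
  ⟨{.tick, .close, .zero, .one}, fun x => by cases x <;> decide⟩

/-- A natural number in unary. As the size of an instance with `n` variables and `m` constraints is
at least `n`, writing `n` and the variable indices in unary changes sizes only polynomially. -/
def ParitySymbol.encodeNat (a : ℕ) : List ParitySymbol :=
  List.replicate a .tick ++ [.close]

/-- A constraint as a string: its right-hand side, then its `k` variables. -/
def ParityConstraint.encode {k n : ℕ} (C : ParityConstraint k n) : List ParitySymbol :=
  (if C.rhs = 0 then .zero else .one) ::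
    (List.ofFn fun j => ParitySymbol.encodeNat (C.var j)).flatten

/-- A `k`-Parity instance as a string: the number of variables, then all constraints. -/
def ParityInstance.encode {k : ℕ} (Φ : ParityInstance k) : List ParitySymbol :=
  ParitySymbol.encodeNat Φ.numVars ++ (Φ.constraints.map ParityConstraint.encode).flatten

/-! ### Finite representations of real numbers -/

/-- Arithmetic expressions over natural numbers and three real parameters. -/
inductive RealExpr
  | nat (a : ℕ)
  | param (i : Fin 3)
  | add (x y : RealExpr)
  | sub (x y : RealExpr)
  | mul (x y : RealExpr)
  | div (x y : RealExpr)
  | pow (x y : RealExpr)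

namespace RealExpr

/-- The real number denoted by an expression, for the values `θ` of the parameters. -/
def eval (θ : Fin 3 → ℝ) : RealExpr → ℝ
  | nat a => a
  | param i => θ i
  | add x y => x.eval θ + y.eval θ
  | sub x y => x.eval θ - y.eval θ
  | mul x y => x.eval θ * y.eval θ
  | div x y => x.eval θ / y.eval θ
  | pow x y => x.eval θ ^ y.eval θ

/-- The expression is meaningful: no denominator vanishes and only positive numbers are raised to
real powers. -/
def WellDefined (θ : Fin 3 → ℝ) : RealExpr → Prop
  | nat _ => True
  | param _ => True
  | add x y => x.WellDefined θ ∧ y.WellDefined θ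
  | sub x y => x.WellDefined θ ∧ y.WellDefined θ
  | mul x y => x.WellDefined θ ∧ y.WellDefined θ
  | div x y => x.WellDefined θ ∧ y.WellDefined θ ∧ y.eval θ ≠ 0
  | pow x y => x.WellDefined θ ∧ y.WellDefined θ ∧ 0 < x.eval θ

/-- The number of arithmetic operations in an expression. -/
def numOps : RealExpr → ℕ
  | nat _ => 0
  | param _ => 0
  | add x y => x.numOps + y.numOps + 1
  | sub x y => x.numOps + y.numOps + 1
  | mul x y => x.numOps + y.numOps + 1
  | div x y => x.numOps + y.numOps + 1
  | pow x y => x.numOps + y.numOps + 1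

end RealExpr

/-- The alphabet for `CVP` instances. -/
inductive CVPSymbol
  | tick
  | close
  | param (i : Fin 3)
  | add
  | sub
  | mul
  | div
  | pow
  | row
  deriving DecidableEq, Fintype

/-- A natural number in unary. -/
def CVPSymbol.encodeNat (a : ℕ) : List CVPSymbol :=
  List.replicate a .tick ++ [.close]

/-- An expression as a string, in prefix (Polish) notation. -/
def RealExpr.encode : RealExpr → List CVPSymbol
  | nat a => CVPSymbol.encodeNat a
  | param i => [.param i]
  | add x y => .add :: (x.encode ++ y.encode)
  | sub x y => .sub :: (x.encode ++ y.encode)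
  | mul x y => .mul :: (x.encode ++ y.encode)
  | div x y => .div :: (x.encode ++ y.encode)
  | pow x y => .pow :: (x.encode ++ y.encode)

/-! ### The closest vector problem -/

/-- The `ℓ_p` norm of a vector, for real `p ≥ 1`. -/
def lpNorm (p : ℝ) {d : ℕ} (v : Fin d → ℝ) : ℝ :=
  ‖WithLp.toLp (ENNReal.ofReal p) v‖

/-- The set of all integer combinations of the columns of `B`. -/
def latticeOf {d n : ℕ} (B : Matrix (Fin d) (Fin n) ℝ) : Submodule ℤ (Fin d → ℝ) :=
  Submodule.span ℤ (Set.range fun j => B.col j)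

/-- `dist_p(L(B), t)`, the `ℓ_p` distance of `t` to the lattice of `B`. -/
def latticeDist (p : ℝ) {d n : ℕ} (B : Matrix (Fin d) (Fin n) ℝ) (t : Fin d → ℝ) : ℝ :=
  -- The infimum is attained when the columns of `B` are linearly independent.
  ⨅ x : latticeOf B, lpNorm p ((x : Fin d → ℝ) - t)

/-- The data `(B, t, r)` of a closest vector instance: a `dim × rank` matrix, a target and a
distance, with the real numbers given by expressions. -/
structure CVPInstance where
  dim : ℕ
  rank : ℕ
  basis : Matrix (Fin dim) (Fin rank) RealExpr
  target : Fin dim → RealExpr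
  radius : RealExpr

namespace CVPInstance

/-- The real matrix `B`. -/
def basisVal (I : CVPInstance) (θ : Fin 3 → ℝ) : Matrix (Fin I.dim) (Fin I.rank) ℝ :=
  I.basis.map (RealExpr.eval θ)

/-- The real vector `t`. -/
def targetVal (I : CVPInstance) (θ : Fin 3 → ℝ) : Fin I.dim → ℝ :=
  fun i => (I.target i).eval θ

/-- The real number `r`. -/
def radiusVal (I : CVPInstance) (θ : Fin 3 → ℝ) : ℝ :=
  I.radius.eval θ

/-- Every expression in the instance has the property `P`. -/
def AllExpr (I : CVPInstance) (P : RealExpr → Prop) : Prop :=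
  (∀ i j, P (I.basis i j)) ∧ (∀ i, P (I.target i)) ∧ P I.radius

/-- The data form an instance of `CVP`: all expressions are meaningful, the columns of `B` are a
basis of the lattice they generate (which therefore has rank `I.rank`), and `r > 0`. -/
def IsValid (I : CVPInstance) (θ : Fin 3 → ℝ) : Prop :=
  I.AllExpr (RealExpr.WellDefined θ) ∧
    LinearIndependent ℝ (fun j => (I.basisVal θ).col j) ∧ 0 < I.radiusVal θ

/-- An instance as a string: the rank, then row by row the entries of `B` followed by the entry of
`t`, each row preceded by a marker, and finally `r`. -/
def encode (I : CVPInstance) : List CVPSymbol :=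
  CVPSymbol.encodeNat I.rank ++
    (List.ofFn fun i => CVPSymbol.row ::
      ((List.ofFn fun j => (I.basis i j).encode).flatten ++ (I.target i).encode)).flatten ++
    I.radius.encode

end CVPInstance

/-- `γ-CVP_p`, for instances written with the real parameters `θ`. -/
def GapCVP (θ : Fin 3 → ℝ) (p γ : ℝ) : PromiseProblem CVPInstance where
  yes := {I | I.IsValid θ ∧
    latticeDist p (I.basisVal θ) (I.targetVal θ) ≤ I.radiusVal θ}
  no := {I | I.IsValid θ ∧
    γ * I.radiusVal θ < latticeDist p (I.basisVal θ) (I.targetVal θ)}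

end

/-! Let `K` be the even one of `k` and `k + 1`. A constraint has `K` slots: the slot of a variable
with value `x` holds `Y = 1 - 2x`, a padding slot holds `1`. Its rows are the forms `⟨ε, Y⟩` for all
sign vectors `ε` with a fixed product. If `Y` is itself a sign vector `u`, the substitution `ε ↦ uε`
shows that the sum of `|⟨ε, u⟩|^p` depends only on the product of `u`, that is, on the parity of the
variables (`parityCost_units`). So a constraint has only two costs on 0/1 points, and the product of
`ε` is chosen from the right-hand side so that the cheaper one means "satisfied".

The costs differ by the absolute value of `∑ (∏ ε) |∑ ε|^p`, a central difference of order `K` of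
`|x|^p` at `0`. For odd `K` it would vanish by `ε ↦ -ε`, whence the padding. For `K = 2h > p` it is,
up to sign and the factor `2^(-K) π / (2 |sin(πp/2)|)`, the integral of `t^p e^(-tu) sin(u)^K` over
`t, u > 0`, which is positive (`le_abs_sum_signProd_mul_rpow`). The sum of the two costs is a moment
of a random walk, bounded by an exponential moment (`sum_abs_signSum_rpow_le`). Together these give
the constant of the theorem (`parity_gap_constant_le`).

An integer point outside `{0,1}^n` gains nothing: every `Y` is odd, and by convexity replacing the
slot values by their signs does not increase the cost (`parityCost_sign_le`). Hence the `p`-th power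
of the distance is `m · meanCost(val)` for `m` constraints, where `meanCost` is affine and
decreasing in the satisfied fraction. With radius `(m · meanCost c)^(1/p)` the gap is `(meanCost s /
meanCost c)^(1/p)` (`le_cvpGap`).

The rows of a constraint determine its variables, because `K ≥ 3` (`eq_zero_of_sum_signs_eq_zero`);
a variable in no constraint gets a unit row. This makes the columns independent and keeps the rank
at `n`.

Up to the positions of the variables and the number `m`, all strings in the output are constants for
fixed `p` and `k`, including the choice of the cheaper parity, which need not be computed from `p`.
A stack machine with one symbol per variable sweeps over these symbols once for each row, which
takes polynomial time (`run_toFinTM2`). -/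

/-! ### Integrals: Mellin and Laplace transforms. -/

open MeasureTheory in
/-- The integral `∫₀^∞ t^r / (t² + a²) dt`, by writing `1 / (t² + a²)` as a Laplace transform. -/
theorem lintegral_rpow_div_sq_add_sq {r a : ℝ} (hr : -1 < r) (hr' : r < 1) (ha : 0 < a) :
    ∫⁻ t in Set.Ioi (0 : ℝ), ENNReal.ofReal (t ^ r / (t ^ 2 + a ^ 2)) =
      ENNReal.ofReal (a ^ (r - 1) * (Real.pi / (2 * Real.cos (Real.pi * r / 2)))) := by
  have laplace : ∀ q b : ℝ, 0 < q → 0 < b → ∫⁻ s in Set.Ioi (0 : ℝ),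
      ENNReal.ofReal (s ^ (q - 1) * Real.exp (-(b * s))) =
        ENNReal.ofReal ((1 / b) ^ q * Real.Gamma q) := by
    intro q b hq hb
    have h := Real.integral_rpow_mul_exp_neg_mul_Ioi hq hb
    have hpos : 0 < (1 / b) ^ q * Real.Gamma q :=
      mul_pos (Real.rpow_pos_of_pos (by positivity) _) (Real.Gamma_pos_of_pos hq)
    rw [← h, ofReal_integral_eq_lintegral_ofReal
      (Integrable.of_integral_ne_zero (by rw [h]; exact hpos.ne'))]
    exact (ae_restrict_mem measurableSet_Ioi).mono fun s hs =>
      mul_nonneg (Real.rpow_nonneg (le_of_lt hs) _) (Real.exp_nonneg _)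
  have gauss : ∀ s : ℝ, 0 < s → ∫⁻ t in Set.Ioi (0 : ℝ),
      ENNReal.ofReal (t ^ r * Real.exp (-(s * t ^ 2))) =
        ENNReal.ofReal (s ^ (-(r + 1) / 2) * (1 / 2) * Real.Gamma ((r + 1) / 2)) := by
    intro s hs
    have h := integral_rpow_mul_exp_neg_mul_rpow (p := 2) (q := r) (b := s) (by norm_num) hr hs
    have hpos : 0 < s ^ (-(r + 1) / 2) * (1 / 2) * Real.Gamma ((r + 1) / 2) :=
      mul_pos (by positivity) (Real.Gamma_pos_of_pos (by linarith))
    simp only [Real.rpow_two, neg_mul] at h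
    rw [← h, ofReal_integral_eq_lintegral_ofReal
      (Integrable.of_integral_ne_zero (by rw [h]; exact hpos.ne'))]
    exact (ae_restrict_mem measurableSet_Ioi).mono fun s hs =>
      mul_nonneg (Real.rpow_nonneg (le_of_lt hs) _) (Real.exp_nonneg _)
  calc ∫⁻ t in Set.Ioi (0 : ℝ), ENNReal.ofReal (t ^ r / (t ^ 2 + a ^ 2))
      = ∫⁻ t in Set.Ioi (0 : ℝ), ∫⁻ s in Set.Ioi (0 : ℝ),
          ENNReal.ofReal (t ^ r) * ENNReal.ofReal (Real.exp (-((t ^ 2 + a ^ 2) * s))) := by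
        refine setLIntegral_congr_fun measurableSet_Ioi fun t ht => ?_
        have ht' : (0 : ℝ) < t := ht
        have h := laplace 1 (t ^ 2 + a ^ 2) one_pos (by positivity)
        simp only [sub_self, Real.rpow_zero, one_mul, Real.rpow_one, Real.Gamma_one, mul_one] at h
        rw [lintegral_const_mul _ (by fun_prop), h,
          ← ENNReal.ofReal_mul (Real.rpow_nonneg ht'.le _), mul_one_div]
    _ = ∫⁻ s in Set.Ioi (0 : ℝ), ∫⁻ t in Set.Ioi (0 : ℝ),
          ENNReal.ofReal (t ^ r) * ENNReal.ofReal (Real.exp (-((t ^ 2 + a ^ 2) * s))) := by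
        rw [lintegral_lintegral_swap]
        exact (Measurable.aemeasurable (by fun_prop))
    _ = ∫⁻ s in Set.Ioi (0 : ℝ), ENNReal.ofReal (1 / 2 * Real.Gamma ((r + 1) / 2)) *
          ENNReal.ofReal (s ^ ((1 - r) / 2 - 1) * Real.exp (-(a ^ 2 * s))) := by
        refine setLIntegral_congr_fun measurableSet_Ioi fun s hs => ?_
        have hs' : (0 : ℝ) < s := hs
        have : ∀ t ∈ Set.Ioi (0 : ℝ),
            ENNReal.ofReal (t ^ r) * ENNReal.ofReal (Real.exp (-((t ^ 2 + a ^ 2) * s))) =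
            ENNReal.ofReal (Real.exp (-(a ^ 2 * s))) *
              ENNReal.ofReal (t ^ r * Real.exp (-(s * t ^ 2))) := by
          intro t ht
          rw [← ENNReal.ofReal_mul (Real.rpow_nonneg (le_of_lt ht) _),
            ← ENNReal.ofReal_mul (Real.exp_nonneg _), mul_left_comm, ← Real.exp_add]
          congr 3
          ring
        rw [setLIntegral_congr_fun measurableSet_Ioi this, lintegral_const_mul _ (by fun_prop),
          gauss s hs', ← ENNReal.ofReal_mul (Real.exp_nonneg _), ← ENNReal.ofReal_mul
          (mul_nonneg (by norm_num) (Real.Gamma_nonneg_of_nonneg (by linarith))),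
          show (1 - r) / 2 - 1 = -(r + 1) / 2 by ring]
        congr 1
        ring
    _ = _ := by
        have hG : 0 ≤ 1 / 2 * Real.Gamma ((r + 1) / 2) :=
          mul_nonneg (by norm_num) (Real.Gamma_nonneg_of_nonneg (by linarith))
        rw [lintegral_const_mul _ (by fun_prop), laplace ((1 - r) / 2) (a ^ 2) (by linarith)
          (by positivity), ← ENNReal.ofReal_mul hG]
        congr 1
        have h1 := Real.Gamma_mul_Gamma_one_sub ((r + 1) / 2)
        rw [show 1 - (r + 1) / 2 = (1 - r) / 2 by ring,
          show Real.pi * ((r + 1) / 2) = Real.pi * r / 2 + Real.pi / 2 by ring,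
          Real.sin_add_pi_div_two] at h1
        have h2 : (1 / a ^ 2) ^ ((1 - r) / 2) = a ^ (r - 1) := by
          rw [one_div, ← Real.rpow_two, ← Real.rpow_neg ha.le, ← Real.rpow_mul ha.le]
          congr 1
          ring
        rw [h2]
        calc _ = a ^ (r - 1) * (1 / 2 * (Real.Gamma ((r + 1) / 2) * Real.Gamma ((1 - r) / 2))) := by
              ring
          _ = _ := by
              rw [h1]
              congr 1
              rw [mul_comm 2, ← div_div]
              ring

theorem cos_pi_mul_div_two_pos {r : ℝ} (hr : -1 < r) (hr' : r < 1) :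
    0 < Real.cos (Real.pi * r / 2) := by
  have := Real.pi_pos
  exact Real.cos_pos_of_mem_Ioo ⟨by nlinarith, by nlinarith⟩

open MeasureTheory in
-- Tonelli needs no integrability, so the finite value of the `lintegral` yields integrability here
-- as well.
theorem integral_rpow_div_sq_add_sq {r a : ℝ} (hr : -1 < r) (hr' : r < 1) (ha : 0 < a) :
    IntegrableOn (fun t : ℝ => t ^ r / (t ^ 2 + a ^ 2)) (Set.Ioi 0) ∧
    ∫ t in Set.Ioi (0 : ℝ), t ^ r / (t ^ 2 + a ^ 2) =
      a ^ (r - 1) * (Real.pi / (2 * Real.cos (Real.pi * r / 2))) := by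
  have h := lintegral_rpow_div_sq_add_sq hr hr' ha
  have hn : 0 ≤ᵐ[volume.restrict (Set.Ioi 0)] fun t : ℝ => t ^ r / (t ^ 2 + a ^ 2) :=
    (ae_restrict_mem measurableSet_Ioi).mono fun s hs =>
      div_nonneg (Real.rpow_nonneg (le_of_lt hs) _) (by positivity)
  have hm : AEStronglyMeasurable (fun t : ℝ => t ^ r / (t ^ 2 + a ^ 2))
      (volume.restrict (Set.Ioi 0)) := Measurable.aestronglyMeasurable (by fun_prop)
  have hc := cos_pi_mul_div_two_pos hr hr'
  refine ⟨⟨hm, (hasFiniteIntegral_iff_ofReal hn).2 (by rw [h]; exact ENNReal.ofReal_lt_top)⟩, ?_⟩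
  rw [integral_eq_lintegral_of_nonneg_ae hn hm, h, ENNReal.toReal_ofReal]
  positivity

open MeasureTheory in
-- Real part of the integral of `exp((-t + ia)u)`.
theorem integral_exp_neg_mul_cos {t : ℝ} (ht : 0 < t) (a : ℝ) :
    IntegrableOn (fun u : ℝ => Real.exp (-(t * u)) * Real.cos (a * u)) (Set.Ioi 0) ∧
    ∫ u in Set.Ioi (0 : ℝ), Real.exp (-(t * u)) * Real.cos (a * u) = t / (t ^ 2 + a ^ 2) := by
  have hre : (-(t : ℂ) + a * Complex.I).re < 0 := by simpa using ht
  have hE : ∀ u : ℝ, (Complex.exp ((-(t : ℂ) + a * Complex.I) * u)).re =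
      Real.exp (-(t * u)) * Real.cos (a * u) := by
    intro u
    rw [Complex.exp_re]
    simp
  have hint := integrableOn_exp_mul_complex_Ioi hre 0
  have hval := integral_exp_mul_complex_Ioi hre 0
  have h2 := hint.re
  simp only [RCLike.re_to_complex, hE] at h2
  refine ⟨h2, ?_⟩
  have h3 := integral_re hint
  simp only [RCLike.re_to_complex, hE] at h3
  rw [h3, hval]
  simp [Complex.div_re, Complex.normSq_apply, sq]

/-! ### Sign vectors and the central difference of `|x|^p`. -/

/-- The sum of a vector of signs. -/
def signSum {K : ℕ} (ε : Fin K → ℤˣ) : ℤ := ∑ j, (ε j : ℤ)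

/-- The product of a vector of signs. -/
def signProd {K : ℕ} (ε : Fin K → ℤˣ) : ℤˣ := ∏ j, ε j

theorem signProd_mul {K : ℕ} (δ ε : Fin K → ℤˣ) :
    signProd (δ * ε) = signProd δ * signProd ε :=
  Finset.prod_mul_distrib

/-- The generating function of `signSum`. -/
theorem prod_sum_units {K : ℕ} {R : Type*} [CommRing R] (g : ℤˣ → R) :
    ∑ ε : Fin K → ℤˣ, ∏ j, g (ε j) = (g 1 + g (-1)) ^ K := by
  rw [← Fintype.prod_sum fun (_ : Fin K) e => g e]
  simp [UnitsInt.univ]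

/-- A central difference of order `K` kills polynomials of degree below `K`: a monomial in the
expanded power involves fewer than `K` coordinates, and flipping a missing one reverses only the
sign of the product. -/
theorem sum_signProd_mul_signSum_pow {K i : ℕ} (hi : i < K) :
    ∑ ε : Fin K → ℤˣ, ((signProd ε : ℤ) : ℝ) * (signSum ε : ℝ) ^ i = 0 := by
  have key : ∀ φ : Fin i → Fin K,
      ∑ ε : Fin K → ℤˣ, ((signProd ε : ℤ) : ℝ) * ∏ t, ((ε (φ t) : ℤ) : ℝ) = 0 := by
    intro φ
    obtain ⟨j, hj⟩ : ∃ j, ∀ t, φ t ≠ j := by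
      by_contra! h
      have := Fintype.card_le_of_surjective φ h
      simp at this
      omega
    have h := Equiv.sum_comp (Equiv.mulLeft (Pi.mulSingle j (-1) : Fin K → ℤˣ))
      fun ε : Fin K → ℤˣ => ((signProd ε : ℤ) : ℝ) * ∏ t, ((ε (φ t) : ℤ) : ℝ)
    have h1 : signProd (Pi.mulSingle j (-1) : Fin K → ℤˣ) = -1 := by
      simp [signProd, Finset.prod_pi_mulSingle']
    simp only [Equiv.coe_mulLeft, signProd_mul, h1, Pi.mul_apply,
      Pi.mulSingle_eq_of_ne (hj _), one_mul] at h
    simp only [neg_mul, one_mul, Units.val_neg, Int.cast_neg, Finset.sum_neg_distrib] at h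
    linarith
  have expand : ∀ ε : Fin K → ℤˣ, ((signProd ε : ℤ) : ℝ) * (signSum ε : ℝ) ^ i =
      ∑ φ : Fin i → Fin K, ((signProd ε : ℤ) : ℝ) * ∏ t, ((ε (φ t) : ℤ) : ℝ) := by
    intro ε
    rw [signSum, Int.cast_sum, Fintype.sum_pow, Finset.mul_sum]
  simp only [expand]
  rw [Finset.sum_comm]
  exact Finset.sum_eq_zero fun φ _ => key φ

/-- Expand the power of `(e^(iu) - e^(-iu)) / (2i)` over the choices of a term in each factor and
take real parts. -/
theorem sin_pow_eq_sum {h : ℕ} (u : ℝ) :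
    Real.sin u ^ (2 * h) = (-1) ^ h / 2 ^ (2 * h) *
      ∑ ε : Fin (2 * h) → ℤˣ, ((signProd ε : ℤ) : ℝ) * Real.cos (signSum ε * u) := by
  have h1 := prod_sum_units (K := 2 * h)
    fun e : ℤˣ => ((e : ℤ) : ℂ) * Complex.exp ((e : ℤ) * (u * Complex.I))
  have h2 : ∀ ε : Fin (2 * h) → ℤˣ,
      ∏ j, (((ε j : ℤ) : ℂ) * Complex.exp ((ε j : ℤ) * (u * Complex.I))) =
        ((signProd ε : ℤ) : ℂ) * Complex.exp ((signSum ε * u : ℝ) * Complex.I) := by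
    intro ε
    rw [Finset.prod_mul_distrib, ← Complex.exp_sum, ← Finset.sum_mul]
    simp [signProd, signSum, mul_assoc]
  have h3 : Complex.exp (u * Complex.I) - Complex.exp (-(u * Complex.I)) =
      2 * Complex.I * Real.sin u := by
    rw [Complex.ofReal_sin, Complex.sin]
    field_simp
    ring_nf
    simp
    ring
  simp only [h2, Units.val_one, Int.cast_one, one_mul, Units.val_neg, Int.cast_neg, neg_mul,
    ← sub_eq_add_neg, h3] at h1
  have h4 := congrArg Complex.re h1
  have h5 : (2 * Complex.I * Real.sin u) ^ (2 * h) =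
      (((-1) ^ h * 2 ^ (2 * h) * Real.sin u ^ (2 * h) : ℝ) : ℂ) := by
    rw [mul_pow, mul_pow, pow_mul Complex.I, Complex.I_sq]
    push_cast
    ring
  rw [h5, Complex.ofReal_re, Complex.re_sum] at h4
  simp only [← Complex.ofReal_intCast, Complex.re_ofReal_mul, Complex.exp_ofReal_mul_I_re] at h4
  rw [h4]
  have h6 : ((-1 : ℝ) ^ h) * (-1) ^ h = 1 := by rw [← mul_pow]; simp
  field_simp
  rw [← pow_mul, mul_comm h 2, pow_mul]; simp

open MeasureTheory in
theorem integral_exp_neg_mul_sin_pow {h : ℕ} {t : ℝ} (ht : 0 < t) :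
    IntegrableOn (fun u : ℝ => Real.exp (-(t * u)) * Real.sin u ^ (2 * h)) (Set.Ioi 0) ∧
    ∫ u in Set.Ioi (0 : ℝ), Real.exp (-(t * u)) * Real.sin u ^ (2 * h) =
      (-1) ^ h / 2 ^ (2 * h) *
        ∑ ε : Fin (2 * h) → ℤˣ, ((signProd ε : ℤ) : ℝ) * (t / (t ^ 2 + (signSum ε : ℝ) ^ 2)) := by
  have e : ∀ u : ℝ, Real.exp (-(t * u)) * Real.sin u ^ (2 * h) = (-1) ^ h / 2 ^ (2 * h) *
      ∑ ε : Fin (2 * h) → ℤˣ, ((signProd ε : ℤ) : ℝ) *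
        (Real.exp (-(t * u)) * Real.cos (signSum ε * u)) := by
    intro u
    rw [sin_pow_eq_sum, mul_left_comm, Finset.mul_sum]
    congr 1
    exact Finset.sum_congr rfl fun ε _ => by ring
  have hi := fun ε : Fin (2 * h) → ℤˣ =>
    (integral_exp_neg_mul_cos ht (signSum ε)).1.const_mul ((signProd ε : ℤ) : ℝ)
  simp only [e]
  refine ⟨(integrable_finsetSum _ fun ε _ => hi ε).const_mul _, ?_⟩
  rw [integral_const_mul, integral_finsetSum _ fun ε _ => hi ε]
  simp only [integral_const_mul, (integral_exp_neg_mul_cos ht _).2]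

open MeasureTheory in
-- On `(0, π/2]`, `sin u ≥ 2u/π` and `e^(-tu) ≥ e^(-πt/2)`; the rest of the half-line contributes a
-- nonnegative amount.
theorem le_integral_exp_neg_mul_sin_pow {h : ℕ} {t : ℝ} (ht : 0 < t) :
    Real.exp (-(Real.pi / 2 * t)) * (Real.pi / 2 / (2 * h + 1)) ≤
      ∫ u in Set.Ioi (0 : ℝ), Real.exp (-(t * u)) * Real.sin u ^ (2 * h) := by
  have hpi := Real.pi_pos
  have hI := (integral_exp_neg_mul_sin_pow (h := h) ht).1
  have hsub : Set.Ioc 0 (Real.pi / 2) ⊆ Set.Ioi (0 : ℝ) := fun x hx => hx.1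
  have h1 : ∫ u in (0 : ℝ)..(Real.pi / 2), Real.exp (-(Real.pi / 2 * t)) *
      ((2 / Real.pi) ^ (2 * h) * u ^ (2 * h)) =
      Real.exp (-(Real.pi / 2 * t)) * (Real.pi / 2 / (2 * h + 1)) := by
    rw [intervalIntegral.integral_const_mul, intervalIntegral.integral_const_mul, integral_pow]
    have : (2 / Real.pi) ^ (2 * h) * (Real.pi / 2) ^ (2 * h) = 1 := by
      rw [← mul_pow, div_mul_div_cancel₀ hpi.ne']; simp
    push_cast
    rw [zero_pow (by omega), sub_zero, pow_succ, ← mul_div_assoc, ← mul_assoc (_ ^ _), this, one_mul]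
  rw [← h1, intervalIntegral.integral_of_le (by positivity)]
  calc _ ≤ ∫ u in Set.Ioc 0 (Real.pi / 2), Real.exp (-(t * u)) * Real.sin u ^ (2 * h) := by
        refine setIntegral_mono_on ?_ (hI.mono_set hsub) measurableSet_Ioc fun u hu => ?_
        · exact (Continuous.integrableOn_Icc (by fun_prop)).mono_set Set.Ioc_subset_Icc_self
        · rw [← mul_pow]
          have := Real.mul_le_sin hu.1.le hu.2
          have hu0 := hu.1
          exact mul_le_mul (Real.exp_le_exp.2 (by nlinarith [hu.2]))
            (pow_le_pow_left₀ (by positivity) this _) (by positivity) (Real.exp_nonneg _)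
    _ ≤ _ := by
        refine setIntegral_mono_set hI ?_ hsub.eventuallyLE
        exact Filter.Eventually.of_forall fun u =>
          mul_nonneg (Real.exp_nonneg _) ((even_two_mul h).pow_nonneg _)

open MeasureTheory in
/-- A lower bound for the `2h`-th central difference of `|x|^p` at `0`. -/
theorem le_abs_sum_signProd_mul_rpow {p : ℝ} {h : ℕ} (hp : 0 < p) (hp_even : ∀ z : ℤ, p ≠ 2 * (z : ℝ))
    (hph : p < 2 * h) :
    2 ^ (2 * h) * (|Real.sin (Real.pi * p / 2)| * Real.Gamma (p + 1) * (2 / Real.pi) ^ (p + 1)) /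
      (2 * h + 1) ≤
      |∑ ε : Fin (2 * h) → ℤˣ, ((signProd ε : ℤ) : ℝ) * |(signSum ε : ℝ)| ^ p| := by
  have hpi := Real.pi_pos
  -- As `p` is not an even integer, `p/2` lies strictly between consecutive integers; this puts the
  -- exponent `r` into the open interval where the Mellin integral converges.
  obtain ⟨n, hn1, hn2⟩ : ∃ n : ℕ, (2 * n : ℝ) < p ∧ p < 2 * (n + 1) := by
    refine ⟨⌊p / 2⌋₊, lt_of_le_of_ne ?_ fun hh => hp_even ⌊p / 2⌋₊ (by push_cast; exact hh.symm), ?_⟩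
    · have := Nat.floor_le (by positivity : 0 ≤ p / 2); linarith
    · have := Nat.lt_floor_add_one (p / 2); linarith
  have hnh : n < h := by
    have : (2 * n : ℝ) < 2 * h := hn1.trans hph
    exact_mod_cast (mul_lt_mul_iff_right₀ (two_pos : (0 : ℝ) < 2)).1 this
  set r : ℝ := p + 1 - 2 * (n + 1) with hr
  have hr1 : -1 < r := by linarith
  have hr2 : r < 1 := by linarith
  set c : ℝ := Real.pi / (2 * Real.cos (Real.pi * r / 2)) with hc
  have hcos := cos_pi_mul_div_two_pos hr1 hr2
  have hc0 : 0 < c := by positivity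
  set S : ℝ := ∑ ε : Fin (2 * h) → ℤˣ, ((signProd ε : ℤ) : ℝ) * |(signSum ε : ℝ)| ^ p with hS
  have hcs : Real.cos (Real.pi * r / 2) = |Real.sin (Real.pi * p / 2)| := by
    rw [← abs_of_pos hcos, hr,
      show Real.pi * (p + 1 - 2 * (n + 1)) / 2 =
        Real.pi * p / 2 + Real.pi / 2 - ((n + 1 : ℕ) : ℝ) * Real.pi by push_cast; ring,
      Real.cos_sub_nat_mul_pi, Real.cos_add_pi_div_two, abs_mul, abs_pow, abs_neg, abs_one, one_pow,
      one_mul, abs_neg]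
  -- Dividing `t^(p+1)` by `t² + a²` leaves the remainder `t^r (-a²)^(n+1) / (t² + a²)` and a
  -- polynomial in `a` of degree `2n < 2h`. The signed sum annihilates the polynomial, and only the
  -- remainders are integrable one by one.
  have reduce : ∀ t : ℝ, 0 < t → t ^ p * ∑ ε : Fin (2 * h) → ℤˣ,
      ((signProd ε : ℤ) : ℝ) * (t / (t ^ 2 + (signSum ε : ℝ) ^ 2)) =
      ∑ ε : Fin (2 * h) → ℤˣ, ((signProd ε : ℤ) : ℝ) * (-(signSum ε : ℝ) ^ 2) ^ (n + 1) *
        (t ^ r / (t ^ 2 + (signSum ε : ℝ) ^ 2)) := by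
    intro t ht
    have ht1 : t ^ p * t = t ^ r * (t ^ 2) ^ (n + 1) := by
      rw [← pow_mul, ← Real.rpow_natCast, ← Real.rpow_add ht, ← Real.rpow_add_one ht.ne', hr]
      congr 1
      push_cast
      ring
    have term : ∀ a : ℝ, t ^ p * (t / (t ^ 2 + a ^ 2)) =
        (-a ^ 2) ^ (n + 1) * (t ^ r / (t ^ 2 + a ^ 2)) +
        ∑ i ∈ Finset.range (n + 1), t ^ r * (t ^ 2) ^ i * (-1) ^ (n - i) * a ^ (2 * (n - i)) := by
      intro a
      have hg := (Commute.all (t ^ 2) (-a ^ 2)).geom_sum₂_mul (n + 1)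
      rw [sub_neg_eq_add] at hg
      have hpos : t ^ 2 + a ^ 2 ≠ 0 := by positivity
      have hsum : ∑ i ∈ Finset.range (n + 1),
          t ^ r * (t ^ 2) ^ i * (-1) ^ (n - i) * a ^ (2 * (n - i)) =
          t ^ r * ∑ i ∈ Finset.range (n + 1), (t ^ 2) ^ i * (-a ^ 2) ^ (n + 1 - 1 - i) := by
        rw [Finset.mul_sum]
        refine Finset.sum_congr rfl fun i _ => ?_
        rw [neg_pow, pow_mul a, Nat.add_sub_cancel]
        ring
      rw [hsum]
      field_simp
      rw [ht1]
      linear_combination -(t ^ r) * hg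
    have vanish : ∑ ε : Fin (2 * h) → ℤˣ, ((signProd ε : ℤ) : ℝ) *
        ∑ i ∈ Finset.range (n + 1),
          t ^ r * (t ^ 2) ^ i * (-1) ^ (n - i) * (signSum ε : ℝ) ^ (2 * (n - i)) = 0 := by
      simp only [Finset.mul_sum]
      rw [Finset.sum_comm]
      refine Finset.sum_eq_zero fun i _ => ?_
      have := sum_signProd_mul_signSum_pow (K := 2 * h) (i := 2 * (n - i)) (by omega)
      calc _ = t ^ r * (t ^ 2) ^ i * (-1) ^ (n - i) * ∑ ε : Fin (2 * h) → ℤˣ,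
            ((signProd ε : ℤ) : ℝ) * (signSum ε : ℝ) ^ (2 * (n - i)) := by
            rw [Finset.mul_sum]
            exact Finset.sum_congr rfl fun ε _ => by ring
        _ = 0 := by rw [this, mul_zero]
    rw [Finset.mul_sum]
    calc _ = ∑ ε : Fin (2 * h) → ℤˣ, (((signProd ε : ℤ) : ℝ) * (-(signSum ε : ℝ) ^ 2) ^ (n + 1) *
          (t ^ r / (t ^ 2 + (signSum ε : ℝ) ^ 2)) + ((signProd ε : ℤ) : ℝ) *
          ∑ i ∈ Finset.range (n + 1),
          t ^ r * (t ^ 2) ^ i * (-1) ^ (n - i) * (signSum ε : ℝ) ^ (2 * (n - i))) :=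
          Finset.sum_congr rfl fun ε _ => by rw [mul_left_comm, term]; ring
      _ = _ := by rw [Finset.sum_add_distrib, vanish, add_zero]
  -- The exponents add up as `2(n+1) + (r-1) = p`.
  have hterm : ∀ ε : Fin (2 * h) → ℤˣ, IntegrableOn (fun t : ℝ =>
      ((signProd ε : ℤ) : ℝ) * (-(signSum ε : ℝ) ^ 2) ^ (n + 1) *
        (t ^ r / (t ^ 2 + (signSum ε : ℝ) ^ 2))) (Set.Ioi 0) ∧
      ∫ t in Set.Ioi (0 : ℝ), ((signProd ε : ℤ) : ℝ) * (-(signSum ε : ℝ) ^ 2) ^ (n + 1) *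
        (t ^ r / (t ^ 2 + (signSum ε : ℝ) ^ 2)) =
      (-1) ^ (n + 1) * c * (((signProd ε : ℤ) : ℝ) * |(signSum ε : ℝ)| ^ p) := by
    intro ε
    rcases eq_or_ne (signSum ε : ℝ) 0 with h0 | h0
    · simp [h0, Real.zero_rpow hp.ne', IntegrableOn]
    · have ha : 0 < |(signSum ε : ℝ)| := abs_pos.2 h0
      obtain ⟨hi, hv⟩ := integral_rpow_div_sq_add_sq hr1 hr2 ha
      simp only [sq_abs] at hi hv
      refine ⟨hi.const_mul _, ?_⟩
      have hpow : |(signSum ε : ℝ)| ^ p =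
          (signSum ε : ℝ) ^ (2 * (n + 1)) * |(signSum ε : ℝ)| ^ (r - 1) := by
        rw [pow_mul, ← sq_abs, ← pow_mul, ← Real.rpow_natCast, ← Real.rpow_add ha, hr]
        congr 1
        push_cast
        ring
      rw [integral_const_mul, hv, ← hc, hpow, neg_pow, pow_mul (signSum ε : ℝ)]
      ring
  have hval : ∫ t in Set.Ioi (0 : ℝ), t ^ p *
      ∫ u in Set.Ioi (0 : ℝ), Real.exp (-(t * u)) * Real.sin u ^ (2 * h) =
      (-1) ^ h / 2 ^ (2 * h) * ((-1) ^ (n + 1) * c * S) := by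
    rw [hS, Finset.mul_sum, ← Finset.sum_congr rfl fun ε _ => (hterm ε).2,
      ← integral_finsetSum _ fun ε _ => (hterm ε).1, ← integral_const_mul]
    refine setIntegral_congr_fun measurableSet_Ioi fun t ht => ?_
    rw [(integral_exp_neg_mul_sin_pow ht).2, mul_left_comm, reduce t ht]
  have hint : IntegrableOn (fun t : ℝ => t ^ p *
      ∫ u in Set.Ioi (0 : ℝ), Real.exp (-(t * u)) * Real.sin u ^ (2 * h)) (Set.Ioi 0) := by
    have := ((integrable_finsetSum Finset.univ fun ε _ => (hterm ε).1).const_mul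
      ((-1) ^ h / 2 ^ (2 * h)))
    refine (integrableOn_congr_fun (fun t ht => ?_) measurableSet_Ioi).1 this
    rw [(integral_exp_neg_mul_sin_pow ht).2, mul_left_comm, reduce t ht]
  have hlow := Real.integral_rpow_mul_exp_neg_mul_Ioi (a := p + 1) (r := Real.pi / 2)
    (by linarith) (by positivity)
  simp only [add_sub_cancel_right, one_div_div] at hlow
  have hG : 0 < Real.Gamma (p + 1) := Real.Gamma_pos_of_pos (by linarith)
  -- Insert the lower bound for the inner integral; `∫ t^p e^(-πt/2) dt` gives the Gamma factor.
  have hcomp : (2 / Real.pi) ^ (p + 1) * Real.Gamma (p + 1) * (Real.pi / 2 / (2 * h + 1)) ≤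
      (-1) ^ h / 2 ^ (2 * h) * ((-1) ^ (n + 1) * c * S) := by
    rw [← hlow, ← hval, ← integral_mul_const]
    refine setIntegral_mono_on ?_ hint measurableSet_Ioi fun t ht => ?_
    · refine Integrable.mul_const (Integrable.of_integral_ne_zero ?_) _
      rw [hlow]
      positivity
    · rw [mul_assoc]
      exact mul_le_mul_of_nonneg_left (le_integral_exp_neg_mul_sin_pow ht)
        (Real.rpow_nonneg (le_of_lt ht) _)
  have habs : (-1) ^ h / 2 ^ (2 * h) * ((-1) ^ (n + 1) * c * S) ≤ 1 / 2 ^ (2 * h) * (c * |S|) := by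
    refine (le_abs_self _).trans_eq ?_
    rw [abs_mul, abs_mul, abs_mul, abs_div, abs_pow, abs_pow, abs_pow, abs_neg, abs_one, one_pow,
      one_pow, one_mul, abs_of_pos hc0, abs_two]
  have hfin := hcomp.trans habs
  rw [← hcs]
  rw [hc] at hfin
  have h2 : (0 : ℝ) < 2 * h + 1 := by positivity
  field_simp at hfin ⊢
  linarith

/-! ### Moments of sign sums and the numerical constant. -/

/-- This is `y ≤ e^(y-1)` for `y = l|x|/p`, raised to the power `p`; it is sharp at `|x| = p/l`. -/
theorem abs_rpow_le_exp {p l : ℝ} (hp : 0 < p) (hl : 0 < l) (x : ℝ) :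
    |x| ^ p ≤ (p / (Real.exp 1 * l)) ^ p * Real.exp (l * |x|) := by
  have h1 : l * |x| / p ≤ Real.exp (l * |x| / p - 1) := by
    have := Real.add_one_le_exp (l * |x| / p - 1); linarith
  have h2 := Real.rpow_le_rpow (by positivity) h1 hp.le
  rw [← Real.exp_mul] at h2
  have h3 : |x| = (p / (Real.exp 1 * l)) * (Real.exp 1 * (l * |x| / p)) := by
    field_simp
  calc |x| ^ p = (p / (Real.exp 1 * l)) ^ p * (Real.exp 1 * (l * |x| / p)) ^ p := by
        rw [← Real.mul_rpow (by positivity) (by positivity), ← h3]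
    _ = (p / (Real.exp 1 * l)) ^ p * (Real.exp p * (l * |x| / p) ^ p) := by
        rw [Real.mul_rpow (Real.exp_nonneg _) (by positivity), Real.exp_one_rpow]
    _ ≤ (p / (Real.exp 1 * l)) ^ p * (Real.exp p * Real.exp ((l * |x| / p - 1) * p)) := by
        gcongr
    _ = _ := by
        rw [← Real.exp_add]
        congr 2
        field_simp
        ring

/-- Chernoff's method: the exponential moment is `(2 cosh l)^K ≤ 2^K e^(Kl²/2)`, and `l = √(p/K)`
minimises the resulting bound. The factor `2` comes from treating both signs of the sum. -/
theorem sum_abs_signSum_rpow_le {p : ℝ} {K : ℕ} (hp : 0 < p) (hK : 0 < K) :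
    ∑ ε : Fin K → ℤˣ, |(signSum ε : ℝ)| ^ p ≤
      2 ^ K * (2 * (p * K / Real.exp 1) ^ (p / 2)) := by
  have hK' : (0 : ℝ) < K := by exact_mod_cast hK
  set l := √(p / K) with hl
  have hl0 : 0 < l := Real.sqrt_pos.2 (by positivity)
  have hl2 : l ^ 2 = p / K := Real.sq_sqrt (by positivity)
  have mgf : ∀ b : ℝ, ∑ ε : Fin K → ℤˣ, Real.exp (b * signSum ε) = (2 * Real.cosh b) ^ K := by
    intro b
    have h := prod_sum_units (K := K) fun e : ℤˣ => Real.exp (b * (e : ℤ))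
    rw [Real.cosh_eq]
    simp only [← Real.exp_sum, ← Finset.mul_sum] at h
    simp only [signSum, Int.cast_sum, h]
    congr 1
    simp
    ring
  have habs : ∀ x : ℝ, Real.exp (l * |x|) ≤ Real.exp (l * x) + Real.exp (-l * x) := by
    intro x
    rcases abs_cases x with ⟨h, -⟩ | ⟨h, -⟩ <;> rw [h]
    · linarith [Real.exp_nonneg (-l * x)]
    · rw [mul_neg, ← neg_mul]
      linarith [Real.exp_nonneg (l * x)]
  calc ∑ ε : Fin K → ℤˣ, |(signSum ε : ℝ)| ^ p
      ≤ ∑ ε : Fin K → ℤˣ, (p / (Real.exp 1 * l)) ^ p *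
          (Real.exp (l * signSum ε) + Real.exp (-l * signSum ε)) :=
        Finset.sum_le_sum fun ε _ => (abs_rpow_le_exp hp hl0 _).trans
          (mul_le_mul_of_nonneg_left (habs _) (by positivity))
    _ = (p / (Real.exp 1 * l)) ^ p * (2 * (2 * Real.cosh l) ^ K) := by
        rw [← Finset.mul_sum, Finset.sum_add_distrib, mgf, mgf, Real.cosh_neg]
        ring
    _ ≤ (p / (Real.exp 1 * l)) ^ p * (2 * (2 * Real.exp (l ^ 2 / 2)) ^ K) := by
        gcongr
        exact Real.cosh_le_exp_half_sq l
    _ = 2 ^ K * (2 * ((p / (Real.exp 1 * l)) ^ p * Real.exp (p / 2))) := by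
        rw [mul_pow, ← Real.exp_nat_mul, hl2]
        have : (K : ℝ) * (p / K / 2) = p / 2 := by field_simp
        rw [this]
        ring
    _ = _ := by
        congr 2
        have h1 : (p / (Real.exp 1 * l)) ^ p = (p * K / Real.exp 1 ^ 2) ^ (p / 2) := by
          have : p * K / Real.exp 1 ^ 2 = (p / (Real.exp 1 * l)) ^ (2 : ℝ) := by
            rw [Real.rpow_two, div_pow, mul_pow, hl2]
            field_simp
          rw [this, ← Real.rpow_mul (by positivity)]
          congr 1
          ring
        rw [h1, ← Real.exp_one_rpow (p / 2), ← Real.mul_rpow (by positivity) (by positivity)]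
        congr 1
        field_simp

open MeasureTheory in
-- Keep only `x > p` in the Gamma integral and bound `x^p` below by `p^p`.
theorem rpow_mul_exp_neg_le_Gamma {p : ℝ} (hp : 0 < p) :
    (p / Real.exp 1) ^ p ≤ Real.Gamma (p + 1) := by
  have h := Real.Gamma_eq_integral (s := p + 1) (by linarith)
  have hI := Real.GammaIntegral_convergent (s := p + 1) (by linarith)
  simp only [add_sub_cancel_right] at h hI
  have hsub : Set.Ioi p ⊆ Set.Ioi (0 : ℝ) := Set.Ioi_subset_Ioi hp.le
  rw [h]
  calc (p / Real.exp 1) ^ p = ∫ x in Set.Ioi p, Real.exp (-x) * p ^ p := by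
        rw [integral_mul_const, integral_exp_neg_Ioi, Real.div_rpow hp.le (Real.exp_nonneg _),
          Real.exp_one_rpow, Real.exp_neg]
        ring
    _ ≤ ∫ x in Set.Ioi p, Real.exp (-x) * x ^ p := by
        refine setIntegral_mono_on ((integrableOn_exp_neg_Ioi p).mul_const _) (hI.mono_set hsub)
          measurableSet_Ioi fun x hx => ?_
        have hx' : p < x := hx
        gcongr
    _ ≤ _ := by
        refine setIntegral_mono_set hI ?_ hsub.eventuallyLE
        exact (ae_restrict_mem measurableSet_Ioi).mono fun x hx =>
          mul_nonneg (Real.exp_nonneg _) (Real.rpow_nonneg (le_of_lt hx) _)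

/-- Compares the lower bound for the difference of the two costs with the upper bound for their sum.
The factor `2p` pays for taking the `p`-th root of the gap. -/
theorem parity_gap_constant_le {p : ℝ} {k h : ℕ} (hp : 1 ≤ p) (hp_even : ∀ z : ℤ, p ≠ 2 * (z : ℝ))
    (hk : max 2 p < (k : ℝ)) (h1 : k ≤ 2 * h) (h2 : 2 * h ≤ k + 1) :
    2 * p * (|Real.sin (Real.pi * p / 2)| / (4 * p ^ 3 * (k : ℝ)) *
          (2 * p / (Real.exp 1 ^ 2 * Real.pi ^ 2 * (k : ℝ))) ^ ((p + 1) / 2)) *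
      ∑ ε : Fin (2 * h) → ℤˣ, |(signSum ε : ℝ)| ^ p ≤
    |∑ ε : Fin (2 * h) → ℤˣ, ((signProd ε : ℤ) : ℝ) * |(signSum ε : ℝ)| ^ p| := by
  obtain ⟨hk2, hkp⟩ := max_lt_iff.1 hk
  have hp0 : 0 < p := by linarith
  have hk0 : (0 : ℝ) < k := by linarith
  have h1' : (k : ℝ) ≤ 2 * h := by exact_mod_cast h1
  have h2' : (2 * h : ℝ) ≤ k + 1 := by exact_mod_cast h2
  have hh : 0 < 2 * h := by
    have : (0 : ℝ) < 2 * h := by linarith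
    exact_mod_cast this
  have hpi := Real.pi_pos
  have he := Real.exp_pos 1
  have he2 : 2 ≤ Real.exp 1 := by have := Real.add_one_le_exp (1 : ℝ); linarith
  refine le_trans ?_ (le_abs_sum_signProd_mul_rpow hp0 hp_even (hkp.trans_le h1'))
  refine (mul_le_mul_of_nonneg_left (sum_abs_signSum_rpow_le hp0 hh) (by positivity)).trans ?_
  have hG := rpow_mul_exp_neg_le_Gamma hp0
  set s := |Real.sin (Real.pi * p / 2)|
  have hs : 0 ≤ s := abs_nonneg _
  -- With `q = p/(2e²k)` the base is `(2/π)² q`. The factor `q^(p/2)` will absorb the moment bound,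
  -- and `q^(1/2)` is only needed to be at most `1/2`.
  have e1 : (2 * p / (Real.exp 1 ^ 2 * Real.pi ^ 2 * (k : ℝ))) ^ ((p + 1) / 2) =
      (2 / Real.pi) ^ (p + 1) * ((p / (2 * Real.exp 1 ^ 2 * k)) ^ (p / 2) *
        (p / (2 * Real.exp 1 ^ 2 * k)) ^ (1 / 2 : ℝ)) := by
    rw [← Real.rpow_add (by positivity), ← add_div]
    have : (2 / Real.pi) ^ (p + 1) = ((2 / Real.pi) ^ 2) ^ ((p + 1) / 2) := by
      rw [← Real.rpow_two, ← Real.rpow_mul (by positivity)]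
      congr 1
      ring
    rw [this, ← Real.mul_rpow (by positivity) (by positivity)]
    congr 1
    field_simp
  -- The product of the bases is `(p/e)² · 2h/(2ek)`, and `2h ≤ k + 1 ≤ 2ek`.
  have e2 : (p / (2 * Real.exp 1 ^ 2 * k)) ^ (p / 2) * (p * (2 * h : ℕ) / Real.exp 1) ^ (p / 2) ≤
      (p / Real.exp 1) ^ p := by
    have : (p / Real.exp 1) ^ p = ((p / Real.exp 1) ^ 2) ^ (p / 2) := by
      rw [← Real.rpow_two, ← Real.rpow_mul (by positivity)]
      congr 1
      ring
    rw [this, ← Real.mul_rpow (by positivity) (by positivity)]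
    refine Real.rpow_le_rpow (by positivity) ?_ (by positivity)
    have : p / (2 * Real.exp 1 ^ 2 * k) * (p * (2 * h : ℕ) / Real.exp 1) =
        (p / Real.exp 1) ^ 2 * (2 * h / (2 * Real.exp 1 * k)) := by
      push_cast
      field_simp
    rw [this]
    refine mul_le_of_le_one_right (by positivity) ?_
    rw [div_le_one (by positivity)]
    nlinarith
  have e3 : (p / (2 * Real.exp 1 ^ 2 * k)) ^ (1 / 2 : ℝ) ≤ 1 / 2 := by
    rw [← Real.sqrt_eq_rpow, Real.sqrt_le_left (by norm_num), div_le_iff₀ (by positivity)]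
    have : 4 ≤ Real.exp 1 ^ 2 := by nlinarith
    nlinarith
  -- Uses `2h + 1 ≤ k + 2 ≤ 2k`.
  have e4 : 1 / (p ^ 2 * k) * (1 / 2) ≤ 1 / (2 * h + 1 : ℝ) := by
    rw [div_mul_div_comm, one_mul, div_le_div_iff₀ (by positivity) (by positivity)]
    have : 1 ≤ p ^ 2 := one_le_pow₀ hp
    nlinarith
  rw [e1]
  have hA : 0 ≤ (2 / Real.pi) ^ (p + 1) := by positivity
  calc _ = 2 ^ (2 * h) * (s * (2 / Real.pi) ^ (p + 1)) *
        (((p / (2 * Real.exp 1 ^ 2 * k)) ^ (p / 2) * (p * (2 * h : ℕ) / Real.exp 1) ^ (p / 2)) *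
          (1 / (p ^ 2 * k) * (p / (2 * Real.exp 1 ^ 2 * k)) ^ (1 / 2 : ℝ))) := by
        field_simp
        ring
    _ ≤ 2 ^ (2 * h) * (s * (2 / Real.pi) ^ (p + 1)) *
        (Real.Gamma (p + 1) * (1 / (2 * h + 1 : ℝ))) := by
        refine mul_le_mul_of_nonneg_left (mul_le_mul (e2.trans hG) ?_ (by positivity)
          ((by positivity : (0 : ℝ) ≤ (p / Real.exp 1) ^ p).trans hG)) (by positivity)
        exact (mul_le_mul_of_nonneg_left e3 (by positivity)).trans e4
    _ = _ := by ring

/-! ### Convexity and the cost of a constraint. -/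

/-- `(1+x)^p ≤ e^(px) ≤ 1 + px + (px)²`, and `(px)² ≤ px`. -/
theorem one_add_rpow_le {p x : ℝ} (hp : 0 ≤ p) (hx : 0 ≤ x) (hpx : p * x ≤ 1) :
    (1 + x) ^ p ≤ 1 + 2 * p * x := by
  have h0 : 0 ≤ p * x := by positivity
  have h1 : (1 + x) ^ p ≤ Real.exp (p * x) := by
    rw [mul_comm, Real.exp_mul]
    exact Real.rpow_le_rpow (by linarith) (by linarith [Real.add_one_le_exp x]) hp
  have h2 := (abs_le.1 (Real.abs_exp_sub_one_sub_id_le (x := p * x) (by rwa [abs_of_nonneg h0]))).2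
  nlinarith

/-- An even convex function of `b` grows with `|b|`: `R + b'` and `R - b'` are convex combinations
of `R + b` and `R - b` with interchanged weights. -/
theorem abs_add_rpow_add_abs_sub_rpow_le {p : ℝ} (hp : 1 ≤ p) (R : ℝ) {b b' : ℝ} (h : |b'| ≤ |b|) :
    |R + b'| ^ p + |R - b'| ^ p ≤ |R + b| ^ p + |R - b| ^ p := by
  obtain ⟨θ, hθ0, hθ1, hθ⟩ : ∃ θ : ℝ, 0 ≤ θ ∧ θ ≤ 1 ∧ b' = θ * b - (1 - θ) * b := by
    rcases eq_or_ne b 0 with rfl | hb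
    · exact ⟨0, le_rfl, zero_le_one, by simpa using h⟩
    · have hq : |b' / b| ≤ 1 := by
        rw [abs_div]; exact div_le_one_of_le₀ h (abs_nonneg _)
      obtain ⟨h1, h2⟩ := abs_le.1 hq
      refine ⟨(1 + b' / b) / 2, by linarith, by linarith, ?_⟩
      field_simp
      ring
  have conv : ∀ u v w : ℝ, 0 ≤ w → w ≤ 1 →
      |w * u + (1 - w) * v| ^ p ≤ w * |u| ^ p + (1 - w) * |v| ^ p := by
    intro u v w hw hw'
    have h1 : |w * u + (1 - w) * v| ≤ w * |u| + (1 - w) * |v| := by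
      refine (abs_add_le _ _).trans_eq ?_
      rw [abs_mul, abs_mul, abs_of_nonneg hw, abs_of_nonneg (sub_nonneg.2 hw')]
    exact (Real.rpow_le_rpow (abs_nonneg _) h1 (by linarith)).trans
      ((convexOn_rpow hp).2 (abs_nonneg u) (abs_nonneg v) hw (sub_nonneg.2 hw') (by ring))
  have e1 := conv (R + b) (R - b) θ hθ0 hθ1
  have e2 := conv (R + b) (R - b) (1 - θ) (by linarith) (by linarith)
  rw [show θ * (R + b) + (1 - θ) * (R - b) = R + b' by rw [hθ]; ring] at e1
  rw [show (1 - θ) * (R + b) + (1 - (1 - θ)) * (R - b) = R - b' by rw [hθ]; ring] at e2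
  linarith

/-- The sum of `|⟨ε, Y⟩|^p` over all sign vectors `ε` with product `τ`. -/
noncomputable def parityCost (p : ℝ) {K : ℕ} (τ : ℤˣ) (Y : Fin K → ℤ) : ℝ :=
  ∑ ε : Fin K → ℤˣ, if signProd ε = τ then |((∑ j, (ε j : ℤ) * Y j : ℤ) : ℝ)| ^ p else 0

/-- The value of `parityCost` at sign vectors, as a function of the parity. -/
noncomputable def signCost (p : ℝ) (K : ℕ) (σ : ℤˣ) : ℝ :=
  ∑ ε : Fin K → ℤˣ, if signProd ε = σ then |(signSum ε : ℝ)| ^ p else 0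

theorem signCost_nonneg (p : ℝ) (K : ℕ) (σ : ℤˣ) : 0 ≤ signCost p K σ :=
  Finset.sum_nonneg fun ε _ => by split_ifs <;> positivity

/-- Substitute `ε ↦ δε`. -/
theorem parityCost_mul_left {p : ℝ} {K : ℕ} (δ : Fin K → ℤˣ) (τ : ℤˣ) (Y : Fin K → ℤ) :
    parityCost p (signProd δ * τ) Y = parityCost p τ fun j => (δ j : ℤ) * Y j := by
  unfold parityCost
  rw [← Equiv.sum_comp (Equiv.mulLeft δ)]
  refine Finset.sum_congr rfl fun ε _ => ?_
  simp only [Equiv.coe_mulLeft, signProd_mul, mul_right_inj, Pi.mul_apply, Units.val_mul]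
  simp only [mul_left_comm, mul_assoc]

theorem parityCost_units {p : ℝ} {K : ℕ} (τ : ℤˣ) (u : Fin K → ℤˣ) :
    parityCost p τ (fun j => (u j : ℤ)) = signCost p K (signProd u * τ) := by
  have h := parityCost_mul_left (p := p) u τ fun _ => 1
  simp only [mul_one] at h
  rw [← h]
  simp [parityCost, signCost, signSum]

/-- Flipping the signs at both `i` and `j` preserves the product, so the sign vectors pair up. A
pair contributes `|R + b|^p + |R - b|^p` with `|b|` equal to `|Y i + Y j|` or `|Y i - Y j|`, and
this grows with `|b|`. -/
theorem parityCost_le_of_pair {p : ℝ} (hp : 1 ≤ p) {K : ℕ} (τ : ℤˣ) {Y Y' : Fin K → ℤ} {i j : Fin K}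
    (hij : i ≠ j) (hY : ∀ l, l ≠ i → l ≠ j → Y' l = Y l) (hadd : |Y' i + Y' j| ≤ |Y i + Y j|)
    (hsub : |Y' i - Y' j| ≤ |Y i - Y j|) : parityCost p τ Y' ≤ parityCost p τ Y := by
  set δ : Fin K → ℤˣ := Pi.mulSingle i (-1) * Pi.mulSingle j (-1) with hδ
  have hδ1 : signProd δ = 1 := by
    rw [hδ, signProd_mul]
    simp [signProd, Finset.prod_pi_mulSingle']
  have double : ∀ Z : Fin K → ℤ, 2 * parityCost p τ Z = ∑ ε : Fin K → ℤˣ, if signProd ε = τ then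
      |((∑ l ∈ {i, j}ᶜ, (ε l : ℤ) * Z l : ℤ) : ℝ) + ((ε i * Z i + ε j * Z j : ℤ) : ℝ)| ^ p +
      |((∑ l ∈ {i, j}ᶜ, (ε l : ℤ) * Z l : ℤ) : ℝ) - ((ε i * Z i + ε j * Z j : ℤ) : ℝ)| ^ p
      else 0 := by
    intro Z
    have h := parityCost_mul_left (p := p) δ τ Z
    rw [hδ1, one_mul] at h
    rw [two_mul]
    nth_rewrite 2 [h]
    unfold parityCost
    rw [← Finset.sum_add_distrib]
    refine Finset.sum_congr rfl fun ε _ => ?_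
    have split : ∀ W : Fin K → ℤ, ∑ l, (ε l : ℤ) * W l =
        ∑ l ∈ {i, j}ᶜ, (ε l : ℤ) * W l + (ε i * W i + ε j * W j) := by
      intro W
      rw [← Finset.sum_compl_add_sum {i, j}, Finset.sum_pair hij]
    rw [split, split]
    have hrest : ∑ l ∈ ({i, j} : Finset (Fin K))ᶜ, (ε l : ℤ) * ((δ l : ℤ) * Z l) =
        ∑ l ∈ {i, j}ᶜ, (ε l : ℤ) * Z l := by
      refine Finset.sum_congr rfl fun l hl => ?_
      simp only [Finset.mem_compl, Finset.mem_insert, Finset.mem_singleton, not_or] at hl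
      simp [hδ, Pi.mulSingle_eq_of_ne hl.1, Pi.mulSingle_eq_of_ne hl.2]
    have hi : (δ i : ℤ) = -1 := by simp [hδ, Pi.mulSingle_eq_of_ne hij]
    have hj : (δ j : ℤ) = -1 := by simp [hδ, Pi.mulSingle_eq_of_ne hij.symm]
    rw [hrest, hi, hj]
    split_ifs
    · congr 3 <;> push_cast <;> ring
    · simp
  refine le_of_mul_le_mul_left ?_ (two_pos : (0 : ℝ) < 2)
  rw [double, double]
  refine Finset.sum_le_sum fun ε _ => ?_
  split_ifs with hτ
  · have hrest : ∑ l ∈ ({i, j} : Finset (Fin K))ᶜ, (ε l : ℤ) * Y' l =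
        ∑ l ∈ {i, j}ᶜ, (ε l : ℤ) * Y l := by
      refine Finset.sum_congr rfl fun l hl => ?_
      simp only [Finset.mem_compl, Finset.mem_insert, Finset.mem_singleton, not_or] at hl
      rw [hY l hl.1 hl.2]
    rw [hrest]
    apply abs_add_rpow_add_abs_sub_rpow_le hp
    rw [← Int.cast_abs, ← Int.cast_abs, Int.cast_le]
    rcases Int.units_eq_one_or (ε i) with h1 | h1 <;> rcases Int.units_eq_one_or (ε j) with h2 | h2 <;>
      simp only [h1, h2, Units.val_one, Units.val_neg, one_mul, neg_mul]
    · exact hadd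
    · exact hsub
    · rw [neg_add_eq_sub, neg_add_eq_sub, abs_sub_comm, abs_sub_comm (Y j)]
      exact hsub
    · rw [← neg_add, ← neg_add, abs_neg, abs_neg]
      exact hadd
  · exact le_rfl

theorem abs_sign_add_sign_le {a b : ℤ} (ha : a ≠ 0) (hb : b ≠ 0) :
    |a.sign + b.sign| ≤ |a + b| ∧ |a.sign - b.sign| ≤ |a - b| := by
  rcases lt_or_gt_of_ne ha with h | h <;> rcases lt_or_gt_of_ne hb with h' | h' <;>
    simp only [Int.sign_eq_neg_one_of_neg, Int.sign_eq_one_of_pos, h, h'] <;>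
    have h1 := abs_cases (a + b) <;> have h2 := abs_cases (a - b) <;>
    rw [abs_le, abs_le] <;> omega

/-- Induction on the number of entries that differ from their signs. A single flip would change the
product of `ε`, so a bad entry is replaced together with an arbitrary second one. -/
theorem parityCost_sign_le {p : ℝ} (hp : 1 ≤ p) {K : ℕ} (hK : 2 ≤ K) (τ : ℤˣ) {Y : Fin K → ℤ}
    (hY : ∀ j, Y j ≠ 0) : parityCost p τ (fun j => (Y j).sign) ≤ parityCost p τ Y := by
  induction hn : (Finset.univ.filter fun j => Y j ≠ (Y j).sign).card using Nat.strong_induction_on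
    generalizing Y with
  | _ n ih =>
    by_cases hbad : ∃ i, Y i ≠ (Y i).sign
    · obtain ⟨i, hi⟩ := hbad
      obtain ⟨j, hij⟩ : ∃ j, i ≠ j := by
        have : Nontrivial (Fin K) := Fin.nontrivial_iff_two_le.2 hK
        exact (exists_ne i).imp fun _ h => h.symm
      set Y' : Fin K → ℤ := fun l => if l = i ∨ l = j then (Y l).sign else Y l with hY'
      have hs : ∀ l, (Y' l).sign = (Y l).sign := by
        intro l
        simp only [hY']
        split_ifs <;> simp
      have hlt : (Finset.univ.filter fun l => Y' l ≠ (Y' l).sign).card < n := by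
        rw [← hn]
        refine Finset.card_lt_card (Finset.ssubset_iff_of_subset ?_ |>.2 ⟨i, ?_, ?_⟩)
        · intro l
          simp only [Finset.mem_filter, Finset.mem_univ, true_and, hs]
          simp only [hY']
          split_ifs <;> simp
        · simpa using hi
        · simp [hY']
      have h1 := ih _ hlt (Y := Y') (fun l => by
        rw [Ne, ← Int.sign_eq_zero_iff_zero, hs, Int.sign_eq_zero_iff_zero]; exact hY l) rfl
      simp only [hs] at h1
      obtain ⟨h2, h3⟩ := abs_sign_add_sign_le (hY i) (hY j)
      exact h1.trans (parityCost_le_of_pair hp τ hij (fun l h h' => by simp [hY', h, h'])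
        (by simpa [hY'] using h2) (by simpa [hY'] using h3))
    · push Not at hbad
      exact (congrArg (parityCost p τ) (funext hbad)).ge

theorem signCost_one_add_neg_one (p : ℝ) (K : ℕ) :
    signCost p K 1 + signCost p K (-1) = ∑ ε : Fin K → ℤˣ, |(signSum ε : ℝ)| ^ p := by
  rw [signCost, signCost, ← Finset.sum_add_distrib]
  refine Finset.sum_congr rfl fun ε _ => ?_
  rcases Int.units_eq_one_or (signProd ε) with h | h <;> simp [h]

theorem signCost_one_sub_neg_one (p : ℝ) (K : ℕ) :
    signCost p K 1 - signCost p K (-1) =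
      ∑ ε : Fin K → ℤˣ, ((signProd ε : ℤ) : ℝ) * |(signSum ε : ℝ)| ^ p := by
  rw [signCost, signCost, ← Finset.sum_sub_distrib]
  refine Finset.sum_congr rfl fun ε _ => ?_
  rcases Int.units_eq_one_or (signProd ε) with h | h <;> simp [h]

open Classical in
/-- The parity with the smaller cost. -/
noncomputable def lowParity (p : ℝ) (K : ℕ) : ℤˣ :=
  if signCost p K 1 ≤ signCost p K (-1) then 1 else -1

/-- The smaller of the two costs of a constraint. -/
noncomputable def lowCost (p : ℝ) (K : ℕ) : ℝ := signCost p K (lowParity p K)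

/-- The larger of the two costs of a constraint. -/
noncomputable def highCost (p : ℝ) (K : ℕ) : ℝ := signCost p K (-lowParity p K)

theorem highCost_sub_lowCost (p : ℝ) (K : ℕ) : highCost p K - lowCost p K =
    |∑ ε : Fin K → ℤˣ, ((signProd ε : ℤ) : ℝ) * |(signSum ε : ℝ)| ^ p| := by
  rw [← signCost_one_sub_neg_one, highCost, lowCost, lowParity]
  split_ifs with h
  · rw [abs_of_nonpos (by linarith)]; ring
  · rw [abs_of_nonneg (by linarith), neg_neg]

theorem lowCost_add_highCost (p : ℝ) (K : ℕ) :
    lowCost p K + highCost p K = ∑ ε : Fin K → ℤˣ, |(signSum ε : ℝ)| ^ p := by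
  rw [← signCost_one_add_neg_one, highCost, lowCost, lowParity]
  split_ifs
  · rfl
  · rw [neg_neg, add_comm]

theorem lowCost_nonneg (p : ℝ) (K : ℕ) : 0 ≤ lowCost p K := signCost_nonneg _ _ _

/-- The sine in the lower bound vanishes only at even integers `p`. -/
theorem lowCost_lt_highCost {p : ℝ} {h : ℕ} (hp : 0 < p) (hp_even : ∀ z : ℤ, p ≠ 2 * (z : ℝ))
    (hph : p < 2 * h) : lowCost p (2 * h) < highCost p (2 * h) := by
  rw [← sub_pos, highCost_sub_lowCost]
  refine lt_of_lt_of_le ?_ (le_abs_sum_signProd_mul_rpow hp hp_even hph)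
  have hG : 0 < Real.Gamma (p + 1) := Real.Gamma_pos_of_pos (by linarith)
  have hpi := Real.pi_pos
  have hsin : Real.sin (Real.pi * p / 2) ≠ 0 := by
    rw [Real.sin_ne_zero_iff]
    intro z hz
    refine hp_even z ?_
    field_simp at hz
    linarith
  positivity

/-! ### Slots, parities and the cost of an integer point. -/

/-- The number of slots of a constraint: the smallest even number that is at least `k`. -/
def slotCount (k : ℕ) : ℕ := 2 * ((k + 1) / 2)

theorem le_slotCount (k : ℕ) : k ≤ slotCount k := by unfold slotCount; omega

/-- The slot of the `j`-th variable of a constraint. -/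
def slot {k : ℕ} (j : Fin k) : Fin (slotCount k) := Fin.castLE (le_slotCount k) j

theorem slot_injective {k : ℕ} : Function.Injective (slot (k := k)) := Fin.castLE_injective (le_slotCount k)

/-- The values in the slots of a constraint whose variables have the values `x`; an additional slot
has the value `1`. -/
noncomputable def slotValues {k : ℕ} (x : Fin k → ℤ) : Fin (slotCount k) → ℤ :=
  Function.extend slot (fun j => 1 - 2 * x j) 1

/-- Splits `⟨ε, Y⟩` into the entry of the target and the matrix row applied to `x`. -/
theorem sum_mul_slotValues {k : ℕ} (ε : Fin (slotCount k) → ℤˣ) (x : Fin k → ℤ) :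
    ∑ j, (ε j : ℤ) * slotValues x j = signSum ε - 2 * ∑ j, (ε (slot j) : ℤ) * x j := by
  have h : ∑ j, (ε (slot j) : ℤ) * (-2 * x j) = ∑ j, (ε j : ℤ) * (slotValues x j - 1) := by
    refine Fintype.sum_of_injective slot slot_injective _ _ (fun i hi => ?_) fun j => ?_
    · rw [slotValues, Function.extend_apply' _ _ _ hi]
      simp
    · rw [slotValues, slot_injective.extend_apply]
      ring
  simp only [mul_sub, Finset.sum_sub_distrib, mul_one] at h
  have h' : ∑ j, (ε (slot j) : ℤ) * (-2 * x j) = -(2 * ∑ j, (ε (slot j) : ℤ) * x j) := by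
    rw [Finset.mul_sum, ← Finset.sum_neg_distrib]
    exact Finset.sum_congr rfl fun j _ => by ring
  rw [signSum]
  linarith

/-- The sign `(-1)^b`. -/
def ZMod.toSign (b : ZMod 2) : ℤˣ := if b = 0 then 1 else -1

theorem ZMod.toSign_sum {ι : Type*} (s : Finset ι) (y : ι → ZMod 2) :
    ZMod.toSign (∑ i ∈ s, y i) = ∏ i ∈ s, ZMod.toSign (y i) := by
  classical
  have hadd : ∀ a b : ZMod 2, ZMod.toSign (a + b) = ZMod.toSign a * ZMod.toSign b := by decide
  induction s using Finset.induction_on with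
  | empty => rfl
  | insert i s hi ih => rw [Finset.sum_insert hi, Finset.prod_insert hi, hadd, ih]

theorem slotValues_toSign {k : ℕ} {x : Fin k → ℤ} {y : Fin k → ZMod 2}
    (hxy : ∀ j, (1 - 2 * x j).sign = (ZMod.toSign (y j) : ℤ)) :
    ∃ u : Fin (slotCount k) → ℤˣ, (∀ j, (slotValues x j).sign = u j) ∧
      signProd u = ZMod.toSign (∑ j, y j) := by
  refine ⟨Function.extend slot (fun j => ZMod.toSign (y j)) 1, fun j => ?_, ?_⟩
  · by_cases hj : ∃ i, slot i = j
    · obtain ⟨i, rfl⟩ := hj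
      rw [slotValues, slot_injective.extend_apply, slot_injective.extend_apply, hxy]
    · rw [slotValues, Function.extend_apply' _ _ _ hj, Function.extend_apply' _ _ _ hj]
      rfl
  · rw [ZMod.toSign_sum]
    refine (Fintype.prod_of_injective slot slot_injective _ _ (fun i hi => ?_) fun j => ?_).symm
    · rw [Function.extend_apply' _ _ _ hi]
      rfl
    · rw [slot_injective.extend_apply]

theorem slotValues_ne_zero {k : ℕ} (x : Fin k → ℤ) (j : Fin (slotCount k)) :
    slotValues x j ≠ 0 := by
  by_cases hj : ∃ i, slot i = j
  · obtain ⟨i, rfl⟩ := hj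
    rw [slotValues, slot_injective.extend_apply]
    omega
  · rw [slotValues, Function.extend_apply' _ _ _ hj]
    exact one_ne_zero

/-- The product of the signs in the rows of a constraint with the right-hand side `b`. -/
noncomputable def rowParity (p : ℝ) (k : ℕ) (b : Bool) : ℤˣ :=
  if b then -lowParity p (slotCount k) else lowParity p (slotCount k)

/-- The right-hand side of a constraint. -/
def ParityConstraint.bit {k n : ℕ} (C : ParityConstraint k n) : Bool := !decide (C.rhs = 0)

/-- A right-hand side `1` reverses the product required of the rows, so being satisfied always
selects `lowParity`. -/
theorem ParityConstraint.signCost_eq {k n : ℕ} (p : ℝ) (C : ParityConstraint k n)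
    (y : Fin n → ZMod 2) :
    signCost p (slotCount k) (ZMod.toSign (∑ j, y (C.var j)) * rowParity p k C.bit) =
      if C.Sat y then lowCost p (slotCount k) else highCost p (slotCount k) := by
  have h2 : ∀ b : ZMod 2, b = 0 ∨ b = 1 := by decide
  unfold ParityConstraint.Sat rowParity ParityConstraint.bit lowCost highCost
  rcases h2 (∑ j, y (C.var j)) with h | h <;> rcases h2 C.rhs with h' | h' <;>
    simp [h, h', ZMod.toSign]

/-- The assignment records the sign of `1 - 2x`, which is positive exactly when `x ≤ 0`; so rounding
the point means passing to the signs of the slot values. -/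
theorem ParityConstraint.le_parityCost {k n : ℕ} {p : ℝ} (hp : 1 ≤ p) (hk : 2 ≤ k)
    (C : ParityConstraint k n) (x : Fin n → ℤ) :
    (if C.Sat (fun v => if x v ≤ 0 then 0 else 1) then lowCost p (slotCount k)
      else highCost p (slotCount k)) ≤
      parityCost p (rowParity p k C.bit) (slotValues fun j => x (C.var j)) := by
  refine le_trans ?_ (parityCost_sign_le hp (hk.trans (le_slotCount k)) _ (slotValues_ne_zero _))
  obtain ⟨u, hu, hprod⟩ := slotValues_toSign (x := fun j => x (C.var j))
    (y := fun j => if x (C.var j) ≤ 0 then 0 else 1) fun j => by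
      simp only [ZMod.toSign]
      split_ifs with h1 h2 h2
      · rw [Int.sign_eq_one_of_pos (by omega)]; rfl
      · exact absurd rfl h2
      · exact absurd h2 one_ne_zero
      · rw [Int.sign_eq_neg_one_of_neg (by omega)]; rfl
  rw [funext hu, parityCost_units, hprod]
  exact (C.signCost_eq p _).ge

theorem ParityConstraint.parityCost_eq {k n : ℕ} (p : ℝ) (C : ParityConstraint k n)
    {x : Fin n → ℤ} {y : Fin n → ZMod 2}
    (hxy : ∀ j, x (C.var j) = if y (C.var j) = 0 then 0 else 1) :
    parityCost p (rowParity p k C.bit) (slotValues fun j => x (C.var j)) =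
      if C.Sat y then lowCost p (slotCount k) else highCost p (slotCount k) := by
  have hsign : ∀ j, (1 - 2 * x (C.var j)) = (ZMod.toSign (y (C.var j)) : ℤ) := by
    intro j
    rw [hxy]
    simp only [ZMod.toSign]
    split_ifs <;> rfl
  obtain ⟨u, hu, hprod⟩ := slotValues_toSign (x := fun j => x (C.var j))
    (y := fun j => y (C.var j)) fun j => by
      simp only [hsign]
      rcases Int.units_eq_one_or (ZMod.toSign (y (C.var j))) with h | h <;> rw [h] <;> rfl
  have hval : (slotValues fun j => x (C.var j)) = fun j => (u j : ℤ) := by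
    funext j
    rw [← hu]
    by_cases hj : ∃ i, slot i = j
    · obtain ⟨i, rfl⟩ := hj
      rw [slotValues, slot_injective.extend_apply, hsign]
      rcases Int.units_eq_one_or (ZMod.toSign (y (C.var i))) with h | h <;> rw [h] <;> rfl
    · rw [slotValues, Function.extend_apply' _ _ _ hj]
      rfl
  rw [hval, parityCost_units, hprod, C.signCost_eq]

/-! ### The closest vector instance -/

/-- A row of a closest vector instance: the entries of the matrix and the entry of the target. -/
abbrev CVPRow (n : ℕ) : Type := (Fin n → RealExpr) × RealExpr

/-- The closest vector instance with the given rows. -/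
def CVPInstance.ofRows {n : ℕ} (rows : List (CVPRow n)) (r : RealExpr) : CVPInstance where
  dim := rows.length
  rank := n
  basis := fun i => (rows.get i).1
  target := fun i => (rows.get i).2
  radius := r

/-- The entry of a matrix row, at a column that belongs to the variables `J` of the constraint. -/
def entryExpr {k : ℕ} (τ : ℤˣ) (ε : Fin (slotCount k) → ℤˣ) (J : Fin k → Bool) : RealExpr :=
  if signProd ε = τ then
    .sub (.nat (2 * (Finset.univ.filter fun j => J j = true ∧ ε (slot j) = 1).card))
      (.nat (2 * (Finset.univ.filter fun j => J j = true ∧ ε (slot j) = -1).card))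
  -- A sign vector with the other product gives a row of zeros, so the number of rows does not
  -- depend on the right-hand side.
  else .nat 0

/-- The entry of the target that belongs to a sign vector. -/
def targetExpr {K : ℕ} (τ : ℤˣ) (ε : Fin K → ℤˣ) : RealExpr :=
  if signProd ε = τ then
    .sub (.nat (Finset.univ.filter fun j => ε j = 1).card)
      (.nat (Finset.univ.filter fun j => ε j = -1).card)
  else .nat 0

/-- Literals are natural numbers, so signed integers are written as differences of two counts. -/
theorem card_filter_sub_card_filter {ι : Type*} [Fintype ι] (P : ι → Prop) [DecidablePred P]
    (e : ι → ℤˣ) :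
    ((Finset.univ.filter fun j => P j ∧ e j = 1).card : ℝ) -
      (Finset.univ.filter fun j => P j ∧ e j = -1).card =
      ∑ j, if P j then ((e j : ℤ) : ℝ) else 0 := by
  rw [Finset.card_filter, Finset.card_filter]
  push_cast
  rw [← Finset.sum_sub_distrib]
  refine Finset.sum_congr rfl fun j _ => ?_
  rcases Int.units_eq_one_or (e j) with h | h <;> by_cases hP : P j <;> simp [h, hP]

theorem eval_entryExpr {k : ℕ} (θ : Fin 3 → ℝ) (τ : ℤˣ) (ε : Fin (slotCount k) → ℤˣ)
    (J : Fin k → Bool) : (entryExpr τ ε J).eval θ =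
      if signProd ε = τ then 2 * ∑ j, if J j = true then ((ε (slot j) : ℤ) : ℝ) else 0 else 0 := by
  unfold entryExpr
  split_ifs
  · simp only [RealExpr.eval]
    rw [← card_filter_sub_card_filter]
    push_cast
    ring
  · simp [RealExpr.eval]

theorem eval_targetExpr {K : ℕ} (θ : Fin 3 → ℝ) (τ : ℤˣ) (ε : Fin K → ℤˣ) :
    (targetExpr τ ε).eval θ = if signProd ε = τ then (signSum ε : ℝ) else 0 := by
  unfold targetExpr
  split_ifs
  · simp only [RealExpr.eval]
    have := card_filter_sub_card_filter (fun _ => True) ε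
    simp only [true_and, if_true] at this
    rw [this, signSum]
    push_cast
    rfl
  · simp [RealExpr.eval]

/-- The number of sign vectors. -/
def signCount (K : ℕ) : ℕ := Fintype.card (Fin K → ℤˣ)

/-- An enumeration of the sign vectors. -/
noncomputable def signVector (K : ℕ) : Fin (signCount K) ≃ (Fin K → ℤˣ) :=
  (Fintype.equivFin _).symm

/-- The rows of a constraint. -/
noncomputable def ParityConstraint.rows (p : ℝ) {k n : ℕ} (C : ParityConstraint k n) :
    List (CVPRow n) :=
  List.ofFn fun r : Fin (signCount (slotCount k)) =>
    (fun v => entryExpr (rowParity p k C.bit) (signVector _ r) fun j => decide (C.var j = v),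
      targetExpr (rowParity p k C.bit) (signVector _ r))

/-- The row that fixes the variable `v`. -/
def unitRow {n : ℕ} (v : Fin n) : CVPRow n :=
  (fun w => if w = v then .nat 1 else .nat 0, .nat 0)

/-- The row of zeros. -/
def zeroRow (n : ℕ) : CVPRow n := (fun _ => .nat 0, .nat 0)

/-- The variable `v` occurs in some constraint. -/
def occurs {k n : ℕ} (L : List (ParityConstraint k n)) (v : Fin n) : Bool :=
  L.any fun C => decide (∃ j, C.var j = v)

/-- The variables without a mark. -/
def unmarked {n : ℕ} (used : Fin n → Bool) : List (Fin n) :=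
  (List.finRange n).filter fun v => !used v

/-- The sum of a list of expressions. -/
def RealExpr.sum (L : List RealExpr) : RealExpr := L.foldr .add (.nat 0)

/-- The expression `a ^ p` for a natural number `a`. -/
def RealExpr.natPow (a : ℕ) : RealExpr := if a = 0 then .nat 0 else .pow (.nat a) (.param 0)

/-- `signCost` as an expression. -/
noncomputable def signCostExpr (K : ℕ) (σ : ℤˣ) : RealExpr :=
  .sum ((List.ofFn (signVector K)).map fun ε =>
    if signProd ε = σ then .natPow (signSum ε).natAbs else .nat 0)

/-- The cost per constraint when a fraction `c` of the constraints is satisfied. -/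
noncomputable def meanCostExpr (p : ℝ) (K : ℕ) : RealExpr :=
  .add (.mul (.param 2) (signCostExpr K (lowParity p K)))
    (.mul (.sub (.nat 1) (.param 2)) (signCostExpr K (-lowParity p K)))

/-- The radius for `m` constraints. -/
noncomputable def radiusExpr (p : ℝ) (k m : ℕ) : RealExpr :=
  .pow (.mul (.nat m) (meanCostExpr p (slotCount k))) (.div (.nat 1) (.param 0))

/-- All rows of the closest vector instance of a parity instance. -/
noncomputable def ParityInstance.rows (p : ℝ) {k : ℕ} (Φ : ParityInstance k) :
    List (CVPRow Φ.numVars) :=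
  (Φ.constraints.map (ParityConstraint.rows p)).flatten ++
    ((unmarked (occurs Φ.constraints)).map unitRow ++ [zeroRow _])

/-- The reduction from parity to the closest vector problem. -/
noncomputable def ParityInstance.toCVP (p : ℝ) {k : ℕ} (Φ : ParityInstance k) : CVPInstance :=
  .ofRows (Φ.rows p) (radiusExpr p k Φ.constraints.length)

/-- The absolute value of a coordinate of `B x - t`. -/
noncomputable def CVPRow.absDiff {n : ℕ} (θ : Fin 3 → ℝ) (R : CVPRow n) (x : Fin n → ℤ) : ℝ :=
  |∑ v, (R.1 v).eval θ * x v - R.2.eval θ|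

theorem CVPInstance.lpNorm_ofRows {n : ℕ} {p : ℝ} (hp : 0 < p) (θ : Fin 3 → ℝ)
    (rows : List (CVPRow n)) (r : RealExpr) (x : Fin n → ℤ) :
    lpNorm p ((∑ v, x v • ((CVPInstance.ofRows rows r).basisVal θ).col v) -
      (CVPInstance.ofRows rows r).targetVal θ) =
      (rows.map fun R => R.absDiff θ x ^ p).sum ^ (1 / p) := by
  have hp' : (ENNReal.ofReal p).toReal = p := ENNReal.toReal_ofReal hp.le
  rw [lpNorm, PiLp.norm_eq_sum (by rw [hp']; exact hp), hp']
  congr 1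
  have h : (rows.map fun R => R.absDiff θ x ^ p) =
      List.ofFn fun i : Fin rows.length => (rows.get i).absDiff θ x ^ p := by
    conv_lhs => rw [← List.ofFn_get rows]
    rw [List.map_ofFn]
    rfl
  rw [h, List.sum_ofFn]
  refine Finset.sum_congr rfl fun i _ => ?_
  rw [Real.norm_eq_abs, CVPRow.absDiff]
  congr 2
  simp only [Pi.sub_apply, Finset.sum_apply, zsmul_eq_mul]
  congr 1
  exact Finset.sum_congr rfl fun v _ => mul_comm _ _

theorem mem_latticeOf_iff {d n : ℕ} (B : Matrix (Fin d) (Fin n) ℝ) (w : Fin d → ℝ) :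
    w ∈ latticeOf B ↔ ∃ x : Fin n → ℤ, ∑ v, x v • B.col v = w :=
  Submodule.mem_span_range_iff_exists_fun ℤ

theorem lpNorm_nonneg (p : ℝ) (hp : 1 ≤ p) {d : ℕ} (v : Fin d → ℝ) : 0 ≤ lpNorm p v := by
  have : Fact (1 ≤ ENNReal.ofReal p) := ⟨by simpa using ENNReal.ofReal_le_ofReal hp⟩
  exact norm_nonneg _

theorem latticeDist_le {d n : ℕ} {p : ℝ} (hp : 1 ≤ p) (B : Matrix (Fin d) (Fin n) ℝ)
    (t : Fin d → ℝ) (x : Fin n → ℤ) :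
    latticeDist p B t ≤ lpNorm p ((∑ v, x v • B.col v) - t) :=
  ciInf_le (f := fun w : latticeOf B => lpNorm p ((w : Fin d → ℝ) - t))
    ⟨0, by rintro _ ⟨w, rfl⟩; exact lpNorm_nonneg p hp _⟩ ⟨_, (mem_latticeOf_iff B _).2 ⟨x, rfl⟩⟩

theorem le_latticeDist {d n : ℕ} {p b : ℝ} (B : Matrix (Fin d) (Fin n) ℝ)
    (t : Fin d → ℝ) (h : ∀ x : Fin n → ℤ, b ≤ lpNorm p ((∑ v, x v • B.col v) - t)) :
    b ≤ latticeDist p B t := by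
  refine le_ciInf fun w => ?_
  obtain ⟨x, hx⟩ := (mem_latticeOf_iff B _).1 w.2
  rw [← hx]
  exact h x

/-! ### Evaluation of the rows -/

/-- A variable may fill several slots; its column then carries the sum of their signs. -/
theorem sum_eval_entryExpr {k n : ℕ} (θ : Fin 3 → ℝ) (τ : ℤˣ) (ε : Fin (slotCount k) → ℤˣ)
    (var : Fin k → Fin n) (x : Fin n → ℝ) :
    ∑ v, (entryExpr τ ε fun j => decide (var j = v)).eval θ * x v =
      if signProd ε = τ then 2 * ∑ j, ((ε (slot j) : ℤ) : ℝ) * x (var j) else 0 := by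
  simp only [eval_entryExpr, decide_eq_true_eq]
  split_ifs
  · simp only [mul_assoc, ← Finset.mul_sum, Finset.sum_mul]
    rw [Finset.sum_comm]
    simp
  · simp

theorem sum_rows_constraint {k n : ℕ} {p : ℝ} (hp : 0 < p) (θ : Fin 3 → ℝ)
    (C : ParityConstraint k n) (x : Fin n → ℤ) :
    ((C.rows p).map fun R => R.absDiff θ x ^ p).sum =
      parityCost p (rowParity p k C.bit) (slotValues fun j => x (C.var j)) := by
  rw [ParityConstraint.rows, List.map_ofFn, List.sum_ofFn, parityCost,
    ← Equiv.sum_comp (signVector (slotCount k))]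
  refine Finset.sum_congr rfl fun r _ => ?_
  simp only [Function.comp_apply, CVPRow.absDiff]
  rw [sum_eval_entryExpr (x := fun v => (x v : ℝ)), eval_targetExpr, sum_mul_slotValues]
  split_ifs
  · rw [abs_sub_comm]
    push_cast
    rfl
  · rw [sub_zero, abs_zero, Real.zero_rpow hp.ne']

theorem sum_eval_unitRow {n : ℕ} (θ : Fin 3 → ℝ) (v : Fin n) (x : Fin n → ℝ) :
    ∑ w, ((unitRow v).1 w).eval θ * x w = x v := by
  have : ∀ w, ((unitRow v).1 w).eval θ * x w = if w = v then x w else 0 := by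
    intro w
    simp only [unitRow]
    split_ifs <;> simp [RealExpr.eval]
  simp [this]

theorem ParityInstance.sum_rows {k : ℕ} {p : ℝ} (hp : 0 < p) (θ : Fin 3 → ℝ)
    (Φ : ParityInstance k) (x : Fin Φ.numVars → ℤ) :
    ((Φ.rows p).map fun R => R.absDiff θ x ^ p).sum =
      (Φ.constraints.map fun C =>
        parityCost p (rowParity p k C.bit) (slotValues fun j => x (C.var j))).sum +
      ((unmarked (occurs Φ.constraints)).map fun v => |(x v : ℝ)| ^ p).sum := by
  have hzero : (zeroRow Φ.numVars).absDiff θ x ^ p = 0 := by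
    simp [CVPRow.absDiff, zeroRow, RealExpr.eval, Real.zero_rpow hp.ne']
  have hunit : ∀ v, (unitRow v).absDiff θ x ^ p = |(x v : ℝ)| ^ p := by
    intro v
    rw [CVPRow.absDiff, sum_eval_unitRow (x := fun v => (x v : ℝ))]
    simp [unitRow, RealExpr.eval]
  rw [ParityInstance.rows, List.map_append, List.map_append, List.sum_append, List.sum_append,
    List.map_flatten, List.sum_flatten, List.map_map, List.map_map, List.map_map]
  simp only [List.map_cons, List.map_nil, List.sum_cons, List.sum_nil, hzero, add_zero]
  congr 2
  · exact List.map_congr_left fun C _ => sum_rows_constraint hp θ C x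
  · exact List.map_congr_left fun v _ => hunit v

/-! ### Linear independence -/

/-- Flipping two signs preserves the product, so subtracting gives `ε i z i + ε j z j = 0` for each
admissible `ε`. A third coordinate can correct the product, so both relative signs at `i` and `j`
are admissible and `z i = 0`. -/
theorem eq_zero_of_sum_signs_eq_zero {K : ℕ} (hK : 3 ≤ K) (τ : ℤˣ) (z : Fin K → ℝ)
    (h : ∀ ε : Fin K → ℤˣ, signProd ε = τ → ∑ j, ((ε j : ℤ) : ℝ) * z j = 0) : z = 0 := by
  have hmul : ∀ i : Fin K, ∀ e : ℤˣ, signProd (Pi.mulSingle i e : Fin K → ℤˣ) = e := by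
    intro i e
    simp [signProd, Finset.prod_pi_mulSingle']
  have flip : ∀ i j : Fin K, i ≠ j → ∀ ε : Fin K → ℤˣ, signProd ε = τ →
      ((ε i : ℤ) : ℝ) * z i + ((ε j : ℤ) : ℝ) * z j = 0 := by
    intro i j hij ε hε
    have h1 := h ε hε
    have h2 := h (Pi.mulSingle i (-1) * Pi.mulSingle j (-1) * ε) (by
      rw [signProd_mul, signProd_mul, hmul, hmul, hε]; simp)
    have h3 : ∑ l, ((((Pi.mulSingle i (-1) * Pi.mulSingle j (-1) * ε : Fin K → ℤˣ) l : ℤˣ) : ℤ) : ℝ)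
        * z l = ∑ l, ((ε l : ℤ) : ℝ) * z l -
          ∑ l, (if l = i then 2 * (((ε l : ℤ) : ℝ) * z l) else 0) -
          ∑ l, (if l = j then 2 * (((ε l : ℤ) : ℝ) * z l) else 0) := by
      rw [← Finset.sum_sub_distrib, ← Finset.sum_sub_distrib]
      refine Finset.sum_congr rfl fun l _ => ?_
      rcases eq_or_ne l i with rfl | hi
      · simp [hij]
        ring
      · rcases eq_or_ne l j with rfl | hj
        · simp [hi]
          ring
        · simp [hi, hj]
    rw [h3, h1, Finset.sum_ite_eq', Finset.sum_ite_eq'] at h2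
    simp only [Finset.mem_univ, if_true] at h2
    linarith
  funext i
  obtain ⟨j, hj⟩ : ∃ j, j ≠ i := by
    have : Nontrivial (Fin K) := Fin.nontrivial_iff_two_le.2 (by omega)
    exact exists_ne i
  obtain ⟨l, hl⟩ : ∃ l, l ∉ ({i, j} : Finset (Fin K)) := by
    by_contra! hall
    have := Finset.card_le_card (fun l _ => hall l : Finset.univ ⊆ ({i, j} : Finset (Fin K)))
    have := Finset.card_le_two (a := i) (b := j)
    simp at *
    omega
  simp only [Finset.mem_insert, Finset.mem_singleton, not_or] at hl
  have h1 := flip i j hj.symm (Pi.mulSingle l τ) (hmul l τ)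
  have h2 := flip i j hj.symm (Pi.mulSingle i (-1) * Pi.mulSingle l (-τ)) (by
    rw [signProd_mul, hmul, hmul]; simp)
  simp [Pi.mulSingle_eq_of_ne (Ne.symm hl.1), Pi.mulSingle_eq_of_ne (Ne.symm hl.2),
    Pi.mulSingle_eq_of_ne hj] at h1 h2
  simp only [Pi.zero_apply]
  linarith

theorem CVPInstance.linearIndependent_ofRows {n : ℕ} (θ : Fin 3 → ℝ) (rows : List (CVPRow n))
    (r : RealExpr)
    (h : ∀ x : Fin n → ℝ, (∀ R ∈ rows, ∑ v, (R.1 v).eval θ * x v = 0) → ∀ v, x v = 0) :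
    LinearIndependent ℝ fun j : Fin n => ((CVPInstance.ofRows rows r).basisVal θ).col j := by
  refine Fintype.linearIndependent_iff.2 fun (x : Fin n → ℝ) hx => h x fun R hR => ?_
  obtain ⟨i, rfl⟩ := List.get_of_mem hR
  have h1 : ∀ g : Fin n → Fin rows.length → ℝ, ∑ v, g v = 0 → ∑ v, g v i = 0 := by
    intro g hg
    rw [← Finset.sum_apply, hg, Pi.zero_apply]
  exact Eq.trans (Finset.sum_congr rfl fun v _ => mul_comm _ _) (h1 _ hx)

theorem ParityInstance.eq_zero_of_rows {k : ℕ} (hk : 3 ≤ k) (p : ℝ) (θ : Fin 3 → ℝ)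
    (Φ : ParityInstance k) (x : Fin Φ.numVars → ℝ)
    (hrow : ∀ R ∈ Φ.rows p, ∑ v, (R.1 v).eval θ * x v = 0) : ∀ v, x v = 0 := by
  intro v
  by_cases hv : occurs Φ.constraints v = true
  · obtain ⟨C, hC, hj⟩ := List.any_eq_true.1 hv
    obtain ⟨j, rfl⟩ : ∃ j, C.var j = v := by simpa using hj
    -- The padding slot gets `0`, since it contributes to the target only.
    set z : Fin (slotCount k) → ℝ := Function.extend slot (fun j => x (C.var j)) 0 with hz
    have hz0 : z = 0 := by
      refine eq_zero_of_sum_signs_eq_zero (hk.trans (le_slotCount k)) (rowParity p k C.bit) z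
        fun ε hε => ?_
      have hmem : (fun v => entryExpr (rowParity p k C.bit) ε fun j => decide (C.var j = v),
          targetExpr (rowParity p k C.bit) ε) ∈ Φ.rows p := by
        refine List.mem_append_left _ (List.mem_flatten.2 ⟨_, List.mem_map_of_mem hC, ?_⟩)
        refine (List.mem_ofFn' _ _).2 ⟨(signVector _).symm ε, ?_⟩
        simp only [Equiv.apply_symm_apply]
      have h1 := hrow _ hmem
      simp only at h1
      rw [sum_eval_entryExpr, if_pos hε] at h1
      have h2 : ∑ j, ((ε (slot j) : ℤ) : ℝ) * x (C.var j) = ∑ j, ((ε j : ℤ) : ℝ) * z j := by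
        refine Fintype.sum_of_injective slot slot_injective _ _ (fun i hi => ?_) fun j => ?_
        · rw [hz, Function.extend_apply' _ _ _ hi]
          simp
        · rw [hz, slot_injective.extend_apply]
      linarith
    have := congrFun hz0 (slot j)
    rwa [hz, slot_injective.extend_apply] at this
  · have hmem : unitRow v ∈ Φ.rows p := by
      refine List.mem_append_right _ (List.mem_append_left _ (List.mem_map_of_mem ?_))
      exact List.mem_filter.2 ⟨List.mem_finRange v, by simpa using hv⟩
    have h1 := hrow _ hmem
    rwa [sum_eval_unitRow] at h1

theorem ParityInstance.linearIndependent_col {k : ℕ} (hk : 3 ≤ k) (p : ℝ) (θ : Fin 3 → ℝ)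
    (Φ : ParityInstance k) :
    LinearIndependent ℝ fun j => ((Φ.toCVP p).basisVal θ).col j :=
  CVPInstance.linearIndependent_ofRows θ _ _ (Φ.eq_zero_of_rows hk p θ)

/-! ### The radius as an expression. -/

namespace RealExpr

theorem eval_sum (θ : Fin 3 → ℝ) (L : List RealExpr) :
    (RealExpr.sum L).eval θ = (L.map (eval θ)).sum := by
  induction L with
  | nil => simp [RealExpr.sum, eval]
  | cons x L ih => rw [List.map_cons, List.sum_cons, ← ih]; rfl

theorem wellDefined_sum {θ : Fin 3 → ℝ} {L : List RealExpr} (h : ∀ x ∈ L, x.WellDefined θ) :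
    (RealExpr.sum L).WellDefined θ := by
  induction L with
  | nil => trivial
  | cons x L ih => exact ⟨h x (by simp), ih fun y hy => h y (by simp [hy])⟩

/-- The base `0` must be a literal of its own, because only positive numbers may be raised to real
powers. -/
theorem eval_natPow {θ : Fin 3 → ℝ} (hθ : θ 0 ≠ 0) (a : ℕ) :
    (natPow a).eval θ = (a : ℝ) ^ θ 0 := by
  unfold natPow
  split_ifs with h
  · simp [h, eval, Real.zero_rpow hθ]
  · rfl

theorem wellDefined_natPow (θ : Fin 3 → ℝ) (a : ℕ) : (natPow a).WellDefined θ := by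
  unfold natPow
  split_ifs with h
  · trivial
  · refine ⟨trivial, trivial, ?_⟩
    simpa [eval] using Nat.pos_of_ne_zero h

end RealExpr

theorem eval_signCostExpr {θ : Fin 3 → ℝ} (hθ : θ 0 ≠ 0) (K : ℕ) (σ : ℤˣ) :
    (signCostExpr K σ).eval θ = signCost (θ 0) K σ := by
  rw [signCostExpr, RealExpr.eval_sum, List.map_map, List.map_ofFn, List.sum_ofFn, signCost,
    ← Equiv.sum_comp (signVector K)]
  refine Finset.sum_congr rfl fun r _ => ?_
  simp only [Function.comp_apply]
  split_ifs
  · rw [RealExpr.eval_natPow hθ, Nat.cast_natAbs, Int.cast_abs]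
  · simp [RealExpr.eval]

theorem wellDefined_signCostExpr (θ : Fin 3 → ℝ) (K : ℕ) (σ : ℤˣ) :
    (signCostExpr K σ).WellDefined θ := by
  refine RealExpr.wellDefined_sum fun x hx => ?_
  obtain ⟨ε, -, rfl⟩ := List.mem_map.1 hx
  split_ifs
  · exact RealExpr.wellDefined_natPow _ _
  · trivial

/-- The cost per constraint when a fraction `c` of the constraints is satisfied. -/
noncomputable def meanCost (p : ℝ) (K : ℕ) (c : ℝ) : ℝ :=
  c * lowCost p K + (1 - c) * highCost p K

theorem eval_meanCostExpr {p : ℝ} (hp : p ≠ 0) (s c : ℝ) (K : ℕ) :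
    (meanCostExpr p K).eval ![p, s, c] = meanCost p K c := by
  have hθ : (![p, s, c] : Fin 3 → ℝ) 0 ≠ 0 := hp
  simp only [meanCostExpr, RealExpr.eval, eval_signCostExpr hθ, meanCost, lowCost, highCost]
  simp

theorem wellDefined_meanCostExpr (p : ℝ) (θ : Fin 3 → ℝ) (K : ℕ) :
    (meanCostExpr p K).WellDefined θ :=
  ⟨⟨trivial, wellDefined_signCostExpr _ _ _⟩, ⟨trivial, trivial⟩, wellDefined_signCostExpr _ _ _⟩

theorem meanCost_pos {p : ℝ} {K : ℕ} {c : ℝ} (h : lowCost p K < highCost p K) (hc0 : 0 ≤ c)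
    (hc : c < 1) : 0 < meanCost p K c := by
  have := lowCost_nonneg p K
  unfold meanCost
  have : 0 < (1 - c) * highCost p K := mul_pos (by linarith) (by linarith)
  have : 0 ≤ c * lowCost p K := by positivity
  linarith

theorem eval_radiusExpr {p : ℝ} (hp : p ≠ 0) (s c : ℝ) (k m : ℕ) :
    (radiusExpr p k m).eval ![p, s, c] = (m * meanCost p (slotCount k) c) ^ (1 / p) := by
  simp only [radiusExpr, RealExpr.eval, eval_meanCostExpr hp]
  simp

theorem sum_map_ite_eq {α : Type*} (L : List α) (P : α → Prop) [DecidablePred P] (a b : ℝ) :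
    (L.map fun x => if P x then a else b).sum =
      L.length * b - (L.countP fun x => decide (P x)) * (b - a) := by
  induction L with
  | nil => simp
  | cons x L ih =>
    rw [List.map_cons, List.sum_cons, ih, List.countP_cons, List.length_cons]
    by_cases h : P x <;> simp [h] <;> ring

/-! ### The distance to the target and the validity of the instance. -/

namespace ParityInstance

variable {k : ℕ} (Φ : ParityInstance k)

theorem length_pos : (0 : ℝ) < Φ.constraints.length :=
  Nat.cast_pos.2 (List.length_pos_of_ne_nil Φ.nonempty)

theorem numSat_le_val (y : Fin Φ.numVars → ZMod 2) :
    (Φ.numSat y : ℝ) ≤ Φ.constraints.length * Φ.val := by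
  have h := le_ciSup (f := fun y : Fin Φ.numVars → ZMod 2 =>
    (Φ.numSat y : ℝ) / (Φ.constraints.length : ℝ)) (Set.finite_range _).bddAbove y
  rwa [div_le_iff₀' Φ.length_pos] at h

theorem exists_numSat_eq_val :
    ∃ y : Fin Φ.numVars → ZMod 2, (Φ.numSat y : ℝ) = Φ.constraints.length * Φ.val := by
  obtain ⟨y, hy⟩ := exists_eq_ciSup_of_finite
    (f := fun y : Fin Φ.numVars → ZMod 2 => (Φ.numSat y : ℝ) / (Φ.constraints.length : ℝ))
  exact ⟨y, by rw [ParityInstance.val, ← hy, mul_div_cancel₀ _ Φ.length_pos.ne']⟩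

theorem sum_cost_eq (p : ℝ) (y : Fin Φ.numVars → ZMod 2) :
    (Φ.constraints.map fun C => if C.Sat y then lowCost p (slotCount k)
      else highCost p (slotCount k)).sum =
      Φ.constraints.length * highCost p (slotCount k) -
        Φ.numSat y * (highCost p (slotCount k) - lowCost p (slotCount k)) :=
  sum_map_ite_eq _ _ _ _

theorem latticeDist_toCVP_le {p : ℝ} (hp : 1 ≤ p) (θ : Fin 3 → ℝ) {c : ℝ}
    (hlow : lowCost p (slotCount k) < highCost p (slotCount k)) (hc : c ≤ Φ.val) :
    latticeDist p ((Φ.toCVP p).basisVal θ) ((Φ.toCVP p).targetVal θ) ≤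
      (Φ.constraints.length * meanCost p (slotCount k) c) ^ (1 / p) := by
  obtain ⟨y, hy⟩ := Φ.exists_numSat_eq_val
  -- An optimal assignment, set to `0` on the variables with unit rows so that these rows cost
  -- nothing.
  set x : Fin Φ.numVars → ℤ := fun v =>
    if occurs Φ.constraints v = true then (if y v = 0 then 0 else 1) else 0 with hx
  refine (latticeDist_le hp _ _ x).trans ?_
  refine (CVPInstance.lpNorm_ofRows (by linarith) θ _ _ x).trans_le ?_
  have hcost : (Φ.constraints.map fun C =>
      parityCost p (rowParity p k C.bit) (slotValues fun j => x (C.var j))).sum =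
      (Φ.constraints.map fun C => if C.Sat y then lowCost p (slotCount k)
      else highCost p (slotCount k)).sum := by
    refine congrArg List.sum (List.map_congr_left fun C hC => C.parityCost_eq p fun j => ?_)
    exact if_pos (List.any_eq_true.2 ⟨C, hC, by simp⟩)
  have hunused : ((unmarked (occurs Φ.constraints)).map fun v => |(x v : ℝ)| ^ p).sum = 0 := by
    refine List.sum_eq_zero fun a ha => ?_
    obtain ⟨v, hv, rfl⟩ := List.mem_map.1 ha
    have hv' : ¬ occurs Φ.constraints v = true := by
      simpa using (List.mem_filter.1 hv).2
    simp only [hx, if_neg hv']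
    rw [Int.cast_zero, abs_zero, Real.zero_rpow (by linarith)]
  have hnn : 0 ≤ (Φ.constraints.map fun C => if C.Sat y then lowCost p (slotCount k)
      else highCost p (slotCount k)).sum := by
    refine List.sum_nonneg fun a ha => ?_
    obtain ⟨C, -, rfl⟩ := List.mem_map.1 ha
    split_ifs
    · exact lowCost_nonneg _ _
    · exact signCost_nonneg _ _ _
  rw [Φ.sum_rows (by linarith), hcost, hunused, add_zero]
  refine Real.rpow_le_rpow hnn ?_ (by positivity)
  rw [sum_cost_eq, hy, meanCost]
  have := mul_nonneg (mul_nonneg Φ.length_pos.le (sub_nonneg.2 hc)) (sub_nonneg.2 hlow.le)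
  linarith

theorem le_latticeDist_toCVP {p : ℝ} (hp : 1 ≤ p) (hk : 2 ≤ k) (θ : Fin 3 → ℝ)
    (hlow : lowCost p (slotCount k) < highCost p (slotCount k))
    (hval : 0 ≤ meanCost p (slotCount k) Φ.val) :
    (Φ.constraints.length * meanCost p (slotCount k) Φ.val) ^ (1 / p) ≤
      latticeDist p ((Φ.toCVP p).basisVal θ) ((Φ.toCVP p).targetVal θ) := by
  refine le_latticeDist _ _ fun (x : Fin Φ.numVars → ℤ) => ?_
  refine le_of_le_of_eq ?_ (CVPInstance.lpNorm_ofRows (by linarith) θ _ _ x).symm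
  have hlen := Φ.length_pos
  refine Real.rpow_le_rpow (by positivity) ?_ (by positivity)
  rw [Φ.sum_rows (by linarith)]
  have hunused : 0 ≤ ((unmarked (occurs Φ.constraints)).map fun v => |(x v : ℝ)| ^ p).sum := by
    refine List.sum_nonneg fun a ha => ?_
    obtain ⟨v, -, rfl⟩ := List.mem_map.1 ha
    positivity
  -- The unit rows are dropped, and each constraint costs at least as much as under the rounded
  -- assignment, which satisfies at most a fraction `val` of the constraints.
  have hcost : (Φ.constraints.map fun C => if C.Sat (fun v => if x v ≤ 0 then 0 else 1) then
      lowCost p (slotCount k) else highCost p (slotCount k)).sum ≤ (Φ.constraints.map fun C =>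
      parityCost p (rowParity p k C.bit) (slotValues fun j => x (C.var j))).sum :=
    List.sum_le_sum fun C _ => C.le_parityCost hp hk x
  rw [sum_cost_eq] at hcost
  have hsat := Φ.numSat_le_val fun v => if x v ≤ 0 then 0 else 1
  have := mul_le_mul_of_nonneg_right hsat (sub_nonneg.2 hlow.le)
  rw [meanCost]
  linarith

theorem isValid_toCVP {p : ℝ} (hp : 1 ≤ p) (hk : 3 ≤ k) (s : ℝ) {c : ℝ}
    (hlow : lowCost p (slotCount k) < highCost p (slotCount k)) (hc0 : 0 ≤ c) (hc : c < 1) :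
    (Φ.toCVP p).IsValid ![p, s, c] := by
  have hp0 : p ≠ 0 := by linarith
  have hpos : 0 < Φ.constraints.length * meanCost p (slotCount k) c :=
    mul_pos Φ.length_pos (meanCost_pos hlow hc0 hc)
  have hrows : ∀ R ∈ Φ.rows p, (∀ v, (R.1 v).WellDefined ![p, s, c]) ∧
      R.2.WellDefined ![p, s, c] := by
    intro R hR
    rcases List.mem_append.1 hR with h | h
    · obtain ⟨L, hL, hRL⟩ := List.mem_flatten.1 h
      obtain ⟨C, -, rfl⟩ := List.mem_map.1 hL
      obtain ⟨r, rfl⟩ := (List.mem_ofFn' _ _).1 hRL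
      refine ⟨fun v => ?_, ?_⟩
      · simp only [entryExpr]
        split_ifs <;> simp [RealExpr.WellDefined]
      · simp only [targetExpr]
        split_ifs <;> simp [RealExpr.WellDefined]
    · rcases List.mem_append.1 h with h | h
      · obtain ⟨v, -, rfl⟩ := List.mem_map.1 h
        refine ⟨fun w => ?_, trivial⟩
        simp only [unitRow]
        split_ifs <;> trivial
      · rw [List.mem_singleton.1 h]
        exact ⟨fun _ => trivial, trivial⟩
  refine ⟨⟨fun i j => (hrows _ (List.get_mem _ i)).1 j, fun i => (hrows _ (List.get_mem _ i)).2, ?_⟩,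
    Φ.linearIndependent_col hk p _, ?_⟩
  · refine ⟨⟨trivial, wellDefined_meanCostExpr _ _ _⟩, ⟨trivial, trivial, ?_⟩, ?_⟩
    · simpa [RealExpr.eval] using hp0
    · simpa only [RealExpr.eval, eval_meanCostExpr hp0] using hpos
  · refine lt_of_lt_of_eq (Real.rpow_pos_of_pos hpos (1 / p)) (eval_radiusExpr hp0 s c k _).symm

/-- The number of constraints enters the radius as a literal, so the count of operations is already
that for `m = 0`. -/
theorem allExpr_numOps_le (p : ℝ) :
    (Φ.toCVP p).AllExpr fun x => x.numOps ≤ (radiusExpr p k 0).numOps := by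
  have h1 : 1 ≤ (radiusExpr p k 0).numOps := by simp [radiusExpr, RealExpr.numOps]
  have hrows : ∀ R ∈ Φ.rows p, (∀ v, (R.1 v).numOps ≤ 1) ∧ R.2.numOps ≤ 1 := by
    intro R hR
    rcases List.mem_append.1 hR with h | h
    · obtain ⟨L, hL, hRL⟩ := List.mem_flatten.1 h
      obtain ⟨C, -, rfl⟩ := List.mem_map.1 hL
      obtain ⟨r, rfl⟩ := (List.mem_ofFn' _ _).1 hRL
      refine ⟨fun v => ?_, ?_⟩
      · simp only [entryExpr]
        split_ifs <;> simp [RealExpr.numOps]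
      · simp only [targetExpr]
        split_ifs <;> simp [RealExpr.numOps]
    · rcases List.mem_append.1 h with h | h
      · obtain ⟨v, -, rfl⟩ := List.mem_map.1 h
        refine ⟨fun w => ?_, Nat.zero_le _⟩
        simp only [unitRow]
        split_ifs <;> exact Nat.zero_le _
      · rw [List.mem_singleton.1 h]
        exact ⟨fun _ => Nat.zero_le _, Nat.zero_le _⟩
  exact ⟨fun i j => ((hrows _ (List.get_mem _ i)).1 j).trans h1,
    fun i => ((hrows _ (List.get_mem _ i)).2).trans h1, le_rfl⟩

end ParityInstance

/-! ### The size of the gap and the two promises. -/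

/-- The gap of the reduction. -/
noncomputable def cvpGap (p : ℝ) (k : ℕ) (s c : ℝ) : ℝ :=
  (meanCost p (slotCount k) s / meanCost p (slotCount k) c) ^ (1 / p)

/-- The `p`-th power of the gap is `1 + (c-s)(high - low) / meanCost c`. It suffices that this
exceeds `1 + 2p(c-s)T`, which dominates `(1 + (c-s)T)^p` because `pT ≤ 1`. -/
theorem le_cvpGap {p : ℝ} (hp : 1 ≤ p) (hp_even : ∀ z : ℤ, p ≠ 2 * (z : ℝ))
    {k : ℕ} (hk : max 2 p < (k : ℝ)) {s c : ℝ} (hs : 1 / 2 < s) (hsc : s ≤ c) (hc : c < 1) :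
    1 + (c - s) * (|Real.sin (Real.pi * p / 2)| / (4 * p ^ 3 * (k : ℝ))) *
          (2 * p / (Real.exp 1 ^ 2 * Real.pi ^ 2 * (k : ℝ))) ^ ((p + 1) / 2) ≤ cvpGap p k s c := by
  obtain ⟨hk2, hkp⟩ := max_lt_iff.1 hk
  have hp0 : 0 < p := by linarith
  have hk0 : (0 : ℝ) < k := by linarith
  obtain ⟨h, hh⟩ : ∃ h, slotCount k = 2 * h := ⟨_, rfl⟩
  have hgap := parity_gap_constant_le hp hp_even hk (hh ▸ le_slotCount k)
    (by unfold slotCount at hh; omega)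
  have hlow : lowCost p (slotCount k) < highCost p (slotCount k) := by
    rw [hh]
    refine lowCost_lt_highCost hp0 hp_even (hkp.trans_le ?_)
    exact_mod_cast hh ▸ le_slotCount k
  rw [← highCost_sub_lowCost, ← lowCost_add_highCost, ← hh] at hgap
  set T := |Real.sin (Real.pi * p / 2)| / (4 * p ^ 3 * (k : ℝ)) *
    (2 * p / (Real.exp 1 ^ 2 * Real.pi ^ 2 * (k : ℝ))) ^ ((p + 1) / 2) with hT
  have hpi := Real.pi_gt_three
  have he2 : 2 ≤ Real.exp 1 := by have := Real.add_one_le_exp (1 : ℝ); linarith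
  have hT0 : 0 ≤ T := by positivity
  have hpT : p * T ≤ 1 := by
    have h1 : p * (|Real.sin (Real.pi * p / 2)| / (4 * p ^ 3 * (k : ℝ))) ≤ 1 := by
      rw [← mul_div_assoc, div_le_one (by positivity)]
      have := Real.abs_sin_le_one (Real.pi * p / 2)
      have hp3 : p ≤ p ^ 3 := le_self_pow₀ hp (by norm_num)
      nlinarith [mul_nonneg hp0.le (abs_nonneg (Real.sin (Real.pi * p / 2)))]
    have h2 : (2 * p / (Real.exp 1 ^ 2 * Real.pi ^ 2 * (k : ℝ))) ^ ((p + 1) / 2) ≤ 1 := by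
      refine Real.rpow_le_one (by positivity) ?_ (by positivity)
      rw [div_le_one (by positivity)]
      have h3 : 4 ≤ Real.exp 1 ^ 2 := by nlinarith
      have h4 : 9 ≤ Real.pi ^ 2 := by nlinarith
      have h5 : 36 ≤ Real.exp 1 ^ 2 * Real.pi ^ 2 := by nlinarith
      nlinarith
    rw [hT, ← mul_assoc]
    exact mul_le_one₀ h1 (by positivity) h2
  have hA := meanCost_pos hlow (by linarith : 0 ≤ c) hc
  -- A crude bound for the weighted mean, which brings in the sum of costs that the moment estimate
  -- controls.
  have hAE : meanCost p (slotCount k) c ≤ lowCost p (slotCount k) + highCost p (slotCount k) := by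
    have := lowCost_nonneg p (slotCount k)
    unfold meanCost
    nlinarith
  have hratio : (1 + (c - s) * T) ^ p ≤
      meanCost p (slotCount k) s / meanCost p (slotCount k) c := by
    have hcs : 0 ≤ c - s := by linarith
    refine (one_add_rpow_le hp0.le (by positivity) ?_).trans ?_
    · nlinarith [mul_nonneg hp0.le hT0]
    · rw [le_div_iff₀ hA]
      have h1 : 2 * p * T * meanCost p (slotCount k) c ≤
          highCost p (slotCount k) - lowCost p (slotCount k) :=
        (mul_le_mul_of_nonneg_left hAE (by positivity)).trans hgap
      have h2 := mul_le_mul_of_nonneg_left h1 hcs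
      have h3 : meanCost p (slotCount k) s = meanCost p (slotCount k) c +
          (c - s) * (highCost p (slotCount k) - lowCost p (slotCount k)) := by
        unfold meanCost; ring
      rw [h3]
      linarith
  rw [mul_assoc, ← hT]
  have hbase : 0 ≤ 1 + (c - s) * T := by
    have : 0 ≤ (c - s) * T := mul_nonneg (by linarith) hT0
    linarith
  rw [cvpGap, one_div]
  exact (Real.le_rpow_inv_iff_of_pos hbase ((Real.rpow_nonneg hbase p).trans hratio) hp0).2 hratio

theorem ParityInstance.toCVP_mem_yes {k : ℕ} (Φ : ParityInstance k) {p : ℝ} (hp : 1 ≤ p)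
    (hk : 3 ≤ k) {s c : ℝ} (hlow : lowCost p (slotCount k) < highCost p (slotCount k))
    (hc0 : 0 ≤ c) (hc : c < 1) (γ : ℝ) (h : Φ ∈ (GapParity k s c).yes) :
    Φ.toCVP p ∈ (GapCVP ![p, s, c] p γ).yes :=
  ⟨Φ.isValid_toCVP hp hk s hlow hc0 hc, (Φ.latticeDist_toCVP_le hp _ hlow h).trans_eq
    (eval_radiusExpr (by linarith) s c k _).symm⟩

theorem ParityInstance.toCVP_mem_no {k : ℕ} (Φ : ParityInstance k) {p : ℝ} (hp : 1 ≤ p)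
    (hk : 3 ≤ k) {s c : ℝ} (hlow : lowCost p (slotCount k) < highCost p (slotCount k))
    (hs : 0 ≤ s) (hsc : s ≤ c) (hc : c < 1) (h : Φ ∈ (GapParity k s c).no) :
    Φ.toCVP p ∈ (GapCVP ![p, s, c] p (cvpGap p k s c)).no := by
  have hval : Φ.val < s := h
  have hA := meanCost_pos hlow (hs.trans hsc) hc
  have hB := meanCost_pos hlow hs (hsc.trans_lt hc)
  have hlt : meanCost p (slotCount k) s < meanCost p (slotCount k) Φ.val := by
    have := mul_pos (sub_pos.2 hval) (sub_pos.2 hlow)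
    unfold meanCost
    linarith
  refine ⟨Φ.isValid_toCVP hp hk s hlow (hs.trans hsc) hc, ?_⟩
  refine lt_of_lt_of_le ?_ (Φ.le_latticeDist_toCVP hp (by omega) _ hlow (hB.trans hlt).le)
  have hrad : (Φ.toCVP p).radiusVal ![p, s, c] =
      (Φ.constraints.length * meanCost p (slotCount k) c) ^ (1 / p) :=
    eval_radiusExpr (by linarith) s c k _
  have hlen := Φ.length_pos
  rw [hrad, cvpGap, ← Real.mul_rpow (by positivity) (by positivity)]
  refine Real.rpow_lt_rpow (by positivity) ?_ (by positivity)
  rw [mul_left_comm, div_mul_cancel₀ _ hA.ne']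
  exact mul_lt_mul_of_pos_left hlt hlen

/-! ### Stack machines whose instructions pop one symbol and push strings -/

/-- A stack machine: the instruction at a label pops a symbol from one stack and, depending on the
result, pushes strings on all stacks and halts or goes to another label. -/
structure PopMachine (K : Type) (Γ : K → Type) (Λ : Type) where
  src : Λ → K
  next : (l : Λ) → Option (Γ (src l)) → Option Λ
  out : (l : Λ) → Option (Γ (src l)) → (k : K) → List (Γ k)

namespace PopMachine

variable {K : Type} {Γ : K → Type} {Λ : Type} [DecidableEq K] (M : PopMachine K Γ Λ)

/-- The stacks after the instruction at the label `l`. -/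
def push (l : Λ) (S : ∀ k, List (Γ k)) : ∀ k, List (Γ k) := fun k =>
  M.out l (S (M.src l)).head? k ++ Function.update S (M.src l) (S (M.src l)).tail k

/-- The machine goes from one configuration to another one in at most `t` steps. -/
inductive Run : ℕ → Λ → (∀ k, List (Γ k)) → Λ → (∀ k, List (Γ k)) → Prop
  | refl (t l S) : Run t l S l S
  | step {t l l' l'' S S''} (h : M.next l (S (M.src l)).head? = some l')
      (h' : Run t l' (M.push l S) l'' S'') : Run (t + 1) l S l'' S''

variable {M}

theorem Run.mono {t t' : ℕ} {l l' : Λ} {S S' : ∀ k, List (Γ k)} (h : M.Run t l S l' S')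
    (ht : t ≤ t') : M.Run t' l S l' S' := by
  induction h generalizing t' with
  | refl t l S => exact .refl _ _ _
  | @step t _ _ _ _ _ h _ ih =>
    obtain ⟨u, rfl⟩ : ∃ u, t' = u + 1 := ⟨t' - 1, by omega⟩
    exact .step h (ih (by omega))

theorem Run.trans {t t' : ℕ} {l l' l'' : Λ} {S S' S'' : ∀ k, List (Γ k)} (h : M.Run t l S l' S')
    (h' : M.Run t' l' S' l'' S'') : M.Run (t + t') l S l'' S'' := by
  induction h with
  | refl t l S => exact h'.mono (by omega)
  | @step t _ _ _ _ _ h _ ih =>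
    rw [Nat.add_right_comm]
    exact .step h (ih h')

theorem Run.single {l l' : Λ} {S S' : ∀ k, List (Γ k)}
    (h : M.next l (S (M.src l)).head? = some l') (hS : M.push l S = S') : M.Run 1 l S l' S' :=
  .step h (hS ▸ .refl 0 _ _)

omit [DecidableEq K] in
-- There are only finitely many instructions, hence finitely many output strings.
theorem exists_length_out_le [Finite K] [Finite Λ] [∀ k, Finite (Γ k)] (M : PopMachine K Γ Λ) :
    ∃ c, ∀ l o k, (M.out l o k).length ≤ c := by
  obtain ⟨c, hc⟩ := (Set.finite_range fun x : (Σ l, Option (Γ (M.src l))) × K =>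
    (M.out x.1.1 x.1.2 x.2).length).bddAbove
  exact ⟨c, fun l o k => hc ⟨(⟨l, o⟩, k), rfl⟩⟩

/-- Bounds the output by the running time; the final copying takes as many steps as the output has
symbols. -/
theorem Run.length_le {c : ℕ} (hc : ∀ l o k, (M.out l o k).length ≤ c) {t : ℕ} {l l' : Λ}
    {S S' : ∀ k, List (Γ k)} (h : M.Run t l S l' S') (k : K) :
    (S' k).length ≤ (S k).length + c * t := by
  induction h with
  | refl t l S => omega
  | @step t l _ _ S _ h _ ih =>
    have h1 : (M.push l S k).length ≤ c + (S k).length := by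
      rw [push, List.length_append]
      refine Nat.add_le_add (hc _ _ _) ?_
      rcases eq_or_ne k (M.src l) with rfl | hk
      · simp
      · rw [Function.update_of_ne hk]
    rw [mul_add, mul_one]
    omega

/-! ### Simulation by a `TM2` machine -/

/-- The labels of the simulating machine. -/
abbrev Label (M : PopMachine K Γ Λ) : Type := Λ ⊕ Σ l, Option (Γ (M.src l))

/-- Push a string, the first symbol on top. -/
def pushList {L σ : Type} (k : K) (w : List (Γ k)) (q : Turing.TM2.Stmt Γ L σ) :
    Turing.TM2.Stmt Γ L σ :=
  w.foldl (fun q a => .push k (fun _ => a) q) q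

theorem stepAux_pushList {L σ : Type} (k : K) (w : List (Γ k)) (q : Turing.TM2.Stmt Γ L σ) (v : σ)
    (S : ∀ k, List (Γ k)) : Turing.TM2.stepAux (pushList k w q) v S =
      Turing.TM2.stepAux q v (Function.update S k (w ++ S k)) := by
  induction w generalizing q with
  | nil => simp [pushList]
  | cons a w ih =>
    rw [pushList, List.foldl_cons, ← pushList, ih]
    simp

/-- Push strings on several stacks. -/
def pushAll {L σ : Type} (w : ∀ k, List (Γ k)) (q : Turing.TM2.Stmt Γ L σ) (ks : List K) :
    Turing.TM2.Stmt Γ L σ :=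
  ks.foldr (fun k q => pushList k (w k) q) q

theorem stepAux_pushAll {L σ : Type} (w : ∀ k, List (Γ k)) (q : Turing.TM2.Stmt Γ L σ) {ks : List K}
    (hks : ks.Nodup) (v : σ) (S : ∀ k, List (Γ k)) : Turing.TM2.stepAux (pushAll w q ks) v S =
      Turing.TM2.stepAux q v fun k => if k ∈ ks then w k ++ S k else S k := by
  induction ks generalizing S with
  | nil => simp [pushAll]
  | cons k ks ih =>
    obtain ⟨hk, hks⟩ := List.nodup_cons.1 hks
    rw [pushAll, List.foldr_cons, ← pushAll, stepAux_pushList, ih hks]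
    congr 1
    funext k'
    rcases eq_or_ne k' k with rfl | h
    · simp [hk]
    · simp [h]

open Turing.TM2.Stmt in
/-- The program of the simulating machine. The popped symbol is kept in the state. -/
noncomputable def program [Fintype K] (M : PopMachine K Γ Λ) (main : Λ) :
    M.Label → Turing.TM2.Stmt Γ M.Label M.Label
  | .inl l => pop (M.src l) (fun _ o => .inr ⟨l, o⟩) (goto fun v => v)
  | .inr ⟨l, o⟩ => pushAll (M.out l o)
      -- The state is reset because `haltList` requires the initial state at the end.
      (load (fun _ => .inl main)
        (match M.next l o with
          | some l' => goto fun _ => .inl l'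
          | none => halt)) Finset.univ.toList

/-- The simulating machine. -/
noncomputable def toFinTM2 [Fintype K] [Fintype Λ] [∀ k, Fintype (Γ k)] (M : PopMachine K Γ Λ)
    (main : Λ) (k₀ k₁ : K) : Turing.FinTM2 where
  K := K
  k₀ := k₀
  k₁ := k₁
  Γ := Γ
  Λ := M.Label
  main := .inl main
  σ := M.Label
  initialState := .inl main
  m := M.program main

variable [Fintype K] [Fintype Λ] [∀ k, Fintype (Γ k)]

/-- An instruction costs two steps: pop and remember the symbol, then push and jump. -/
theorem iterate_step_toFinTM2 (main : Λ) (k₀ k₁ : K) (l : Λ) (S : ∀ k, List (Γ k)) :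
    (flip bind (M.toFinTM2 main k₀ k₁).step)^[2]
      (some (⟨some (.inl l), .inl main, S⟩ : (M.toFinTM2 main k₀ k₁).Cfg)) =
      some (⟨(M.next l (S (M.src l)).head?).map .inl, .inl main, M.push l S⟩ :
        (M.toFinTM2 main k₀ k₁).Cfg) := by
  have h1 : (M.toFinTM2 main k₀ k₁).step
      (⟨some (.inl l), .inl main, S⟩ : (M.toFinTM2 main k₀ k₁).Cfg) =
      some (⟨some (.inr ⟨l, (S (M.src l)).head?⟩), .inr ⟨l, (S (M.src l)).head?⟩,
        Function.update S (M.src l) (S (M.src l)).tail⟩ : (M.toFinTM2 main k₀ k₁).Cfg) := rfl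
  have h2 : ∀ (o : Option (Γ (M.src l))) (v : M.Label) (S : ∀ k, List (Γ k)),
      (M.toFinTM2 main k₀ k₁).step (⟨some (.inr ⟨l, o⟩), v, S⟩ : (M.toFinTM2 main k₀ k₁).Cfg) =
      some (⟨(M.next l o).map .inl, .inl main, fun k => M.out l o k ++ S k⟩ :
        (M.toFinTM2 main k₀ k₁).Cfg) := by
    intro o v S
    change some (Turing.TM2.stepAux (M.program main (.inr ⟨l, o⟩)) v S) = _
    rw [program, stepAux_pushAll _ _ (Finset.nodup_toList _)]
    simp only [Finset.mem_toList, Finset.mem_univ, if_true]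
    cases M.next l o <;> rfl
  exact (congrArg (fun o => Option.bind o (M.toFinTM2 main k₀ k₁).step) h1).trans (h2 _ _ _)

theorem Run.evalsTo {main : Λ} {k₀ k₁ : K} {t : ℕ} {l l' : Λ} {S S' : ∀ k, List (Γ k)}
    (h : M.Run t l S l' S') (hhalt : M.next l' (S' (M.src l')).head? = none) :
    Nonempty (StateTransition.EvalsToInTime (M.toFinTM2 main k₀ k₁).step
      (⟨some (.inl l), .inl main, S⟩ : (M.toFinTM2 main k₀ k₁).Cfg)
      -- The instruction at `l'` that halts is counted by the additional `1`.
      (some (⟨none, .inl main, M.push l' S'⟩ : (M.toFinTM2 main k₀ k₁).Cfg)) (2 * (t + 1))) := by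
  induction h with
  | refl t l S =>
    refine ⟨⟨⟨2, ?_⟩, by simp only; omega⟩⟩
    rw [iterate_step_toFinTM2, hhalt]
    rfl
  | @step t l _ _ S _ h _ ih =>
    obtain ⟨e⟩ := ih hhalt
    refine ⟨⟨⟨e.steps + 2, ?_⟩, by have := e.steps_le_m; simp only; omega⟩⟩
    rw [Function.iterate_add_apply, iterate_step_toFinTM2, h]
    exact e.evals_in_steps

theorem initList_toFinTM2 (main : Λ) (k₀ k₁ : K) (w : List (Γ k₀)) :
    Turing.initList (M.toFinTM2 main k₀ k₁) w =
      ⟨some (.inl main), .inl main, Function.update (fun _ => []) k₀ w⟩ := by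
  refine congrArg (Turing.TM2.Cfg.mk _ _) (funext fun (k : K) => ?_)
  by_cases h : k = k₀
  · subst h
    exact (dif_pos rfl).trans (Function.update_self (β := fun k => List (Γ k)) k w fun _ => []).symm
  · exact (dif_neg h).trans (Function.update_of_ne (β := fun k => List (Γ k)) h w fun _ => []).symm

theorem haltList_toFinTM2 (main : Λ) (k₀ k₁ : K) (w : List (Γ k₁)) :
    Turing.haltList (M.toFinTM2 main k₀ k₁) w =
      ⟨none, .inl main, Function.update (fun _ => []) k₁ w⟩ := by
  refine congrArg (Turing.TM2.Cfg.mk _ _) (funext fun (k : K) => ?_)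
  by_cases h : k = k₁
  · subst h
    exact (dif_pos rfl).trans (Function.update_self (β := fun k => List (Γ k)) k w fun _ => []).symm
  · exact (dif_neg h).trans (Function.update_of_ne (β := fun k => List (Γ k)) h w fun _ => []).symm

end PopMachine

/-! ### The machine that computes the reduction -/

/-- The stacks: the input, two stacks with a symbol for each variable, the reversed output, a
counter of the constraints, and the output. -/
inductive ReductionStack
  | inp
  | left
  | right
  | work
  | count
  | res
  deriving DecidableEq

instance : Fintype ReductionStack :=
  ⟨{.inp, .left, .right, .work, .count, .res}, fun s => by cases s <;> decide⟩

/-- The symbol of a variable: its occurrences in the current constraint, and whether it has been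
marked as used. -/
abbrev VarSymbol (k : ℕ) : Type := (Fin k → Bool) × Bool

/-- The alphabets of the stacks. -/
abbrev ReductionStack.Alphabet (k : ℕ) : ReductionStack → Type
  | inp => ParitySymbol
  | left => VarSymbol k
  | right => VarSymbol k
  | work => CVPSymbol
  | count => Unit
  | res => CVPSymbol

instance (k : ℕ) (s : ReductionStack) : Fintype (s.Alphabet k) := by
  cases s <;> dsimp only [ReductionStack.Alphabet] <;> infer_instance

/-- The labels of the machine. -/
inductive ReductionLabel (k R : ℕ)
  | init
  | constr
  | num (b : Bool) (j : Fin k)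
  | move (b : Bool) (j : Fin k)
  | select (b : Bool) (j : Fin k)
  | rewind (b : Bool) (j : Fin k)
  | write (b : Bool) (r : Fin R)
  | back (b : Bool) (r : Fin R)
  | unitPass (found : Bool)
  | unitBack (found : Bool)
  | radius
  | pour
  deriving Fintype

/-- The strings that the machine writes: the entries and targets of the rows of constraints, and the
parts of the radius before and after the unary number of constraints. -/
structure RowStrings (k R : ℕ) where
  entry : Bool → Fin R → (Fin k → Bool) → List CVPSymbol
  target : Bool → Fin R → List CVPSymbol
  before : List CVPSymbol
  after : List CVPSymbol

namespace RowStrings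

open ReductionStack ReductionLabel

variable {k R : ℕ}

/-- The contents of all stacks. -/
def contents (i : List ParitySymbol) (a b : List (VarSymbol k)) (w : List CVPSymbol) (m : List Unit)
    (o : List CVPSymbol) : ∀ s : ReductionStack, List (s.Alphabet k)
  | inp => i
  | left => a
  | right => b
  | work => w
  | count => m
  | res => o

/-- The stack that an instruction pops. -/
def src : ReductionLabel k R → ReductionStack
  | init => inp
  | constr => inp
  | num _ _ => inp
  | move _ _ => left
  | select _ _ => left
  | rewind _ _ => right
  | write _ _ => left
  | back _ _ => right
  | unitPass _ => left
  | unitBack _ => right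
  | radius => count
  | pour => work

/-- Mark a variable as the `j`-th variable of the constraint. -/
def mark (j : Fin k) (a : VarSymbol k) : VarSymbol k := (Function.update a.1 j true, true)

/-- Forget the occurrences in the constraint. -/
def clear (a : VarSymbol k) : VarSymbol k := (fun _ => false, a.2)

/-- The instructions of the machine. -/
def act (D : RowStrings k R) (hk : 0 < k) (hR : 0 < R) :
    (l : ReductionLabel k R) → Option ((src l).Alphabet k) →
      Option (ReductionLabel k R) × ∀ s : ReductionStack, List (s.Alphabet k)
  | init, some ParitySymbol.tick => (some init, contents [] [(fun _ => false, false)] [] [.tick] [] [])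
  | init, some ParitySymbol.close => (some constr, contents [] [] [] [.close] [] [])
  | init, _ => (none, contents [] [] [] [] [] [])
  | constr, some ParitySymbol.zero => (some (num false ⟨0, hk⟩), contents [] [] [] [] [()] [])
  | constr, some ParitySymbol.one => (some (num true ⟨0, hk⟩), contents [] [] [] [] [()] [])
  -- The row marker is written before it is known whether an unmarked variable is left; the last
  -- such row therefore turns out to be `zeroRow`.
  | constr, none => (some (unitPass false), contents [] [] [] [.row] [] [])
  | constr, _ => (none, contents [] [] [] [] [] [])
  -- Each tick of a unary index moves one variable symbol to the right stack; the symbol then on top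
  -- of the left stack is the indexed one.
  | num b j, some ParitySymbol.tick => (some (move b j), contents [] [] [] [] [] [])
  | num b j, some ParitySymbol.close => (some (select b j), contents [] [] [] [] [] [])
  | num _ _, _ => (none, contents [] [] [] [] [] [])
  | move b j, some a => (some (num b j), contents [] [] [a] [] [] [])
  | move _ _, none => (none, contents [] [] [] [] [] [])
  | select b j, some a => (some (rewind b j), contents [] [mark j a] [] [] [] [])
  | select _ _, none => (none, contents [] [] [] [] [] [])
  | rewind b j, some a => (some (rewind b j), contents [] [a] [] [] [] [])
  | rewind b j, none =>
    if h : j + 1 < k then (some (num b ⟨j + 1, h⟩), contents [] [] [] [] [] [])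
    else (some (write b ⟨0, hR⟩), contents [] [] [] [.row] [] [])
  | write b r, some a => (some (write b r), contents [] [] [a] (D.entry b r a.1).reverse [] [])
  | write b r, none => (some (back b r), contents [] [] [] (D.target b r).reverse [] [])
  -- The occurrences are erased during the sweep after the last row; the mark "used" stays.
  | back b r, some a =>
    (some (back b r), contents [] [if r + 1 < R then a else clear a] [] [] [] [])
  | back b r, none =>
    if h : r + 1 < R then (some (write b ⟨r + 1, h⟩), contents [] [] [] [.row] [] [])
    else (some constr, contents [] [] [] [] [] [])
  -- The flag tells whether the entry `1` of this row has been written. The first unmarked variable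
  -- receives it and becomes marked.
  | unitPass f, some a =>
    if f || a.2 then (some (unitPass f), contents [] [] [a] [.close] [] [])
    else (some (unitPass true), contents [] [] [(a.1, true)] [.close, .tick] [] [])
  | unitPass f, none => (some (unitBack f), contents [] [] [] [.close] [] [])
  | unitBack true, some a => (some (unitBack true), contents [] [a] [] [] [] [])
  | unitBack true, none => (some (unitPass false), contents [] [] [] [.row] [] [])
  | unitBack false, some _ => (some (unitBack false), contents [] [] [] [] [] [])
  | unitBack false, none => (some radius, contents [] [] [] D.before.reverse [] [])
  | radius, some _ => (some radius, contents [] [] [] [.tick] [] [])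
  | radius, none => (some pour, contents [] [] [] D.after.reverse [] [])
  | pour, some x => (some pour, contents [] [] [] [] [] [x])
  | pour, none => (none, contents [] [] [] [] [] [])

variable (D : RowStrings k R) (hk : 0 < k) (hR : 0 < R)

/-- The machine. -/
def machine : PopMachine ReductionStack (ReductionStack.Alphabet k) (ReductionLabel k R) where
  src := src
  next l o := (D.act hk hR l o).1
  out l o := (D.act hk hR l o).2

variable {D hk hR}

end RowStrings

/-! ### Runs of the machine on the constraints. -/

namespace RowStrings

open ReductionStack ReductionLabel

variable {k R : ℕ} {D : RowStrings k R} {hk : 0 < k} {hR : 0 < R}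

theorem replicate_append_cons {α : Type*} (n : ℕ) (a : α) (L : List α) :
    List.replicate n a ++ a :: L = List.replicate (n + 1) a ++ L := by
  rw [List.replicate_succ', List.append_assoc]
  rfl

theorem run_init (n : ℕ) (I : List ParitySymbol) (A : List (VarSymbol k)) (W : List CVPSymbol) :
    (D.machine hk hR).Run (n + 1) init (contents (ParitySymbol.encodeNat n ++ I) A [] W [] [])
      constr (contents I (List.replicate n (fun _ => false, false) ++ A) []
        ((CVPSymbol.encodeNat n).reverse ++ W) [] []) := by
  induction n generalizing A W with
  | zero => exact .single rfl (by funext s; cases s <;> rfl)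
  | succ n ih =>
    have h := ih ((fun _ => false, false) :: A) (.tick :: W)
    have hW : (CVPSymbol.encodeNat n).reverse ++ .tick :: W =
        (CVPSymbol.encodeNat (n + 1)).reverse ++ W := by
      simp [CVPSymbol.encodeNat, replicate_append_cons]
    rw [replicate_append_cons, hW] at h
    rw [add_comm (n + 1)]
    exact (PopMachine.Run.single rfl (by funext s; cases s <;> rfl)).trans h

theorem run_num (b : Bool) (j : Fin k) (I : List ParitySymbol) (A A' B : List (VarSymbol k))
    (W : List CVPSymbol) (m : List Unit) :
    (D.machine hk hR).Run (2 * A.length + 1) (num b j)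
      (contents (ParitySymbol.encodeNat A.length ++ I) (A ++ A') B W m [])
      (select b j) (contents I A' (A.reverse ++ B) W m []) := by
  induction A generalizing B with
  | nil => exact .single rfl (by funext s; cases s <;> rfl)
  | cons a A ih =>
    have h := ih (a :: B)
    have hB : A.reverse ++ a :: B = (a :: A).reverse ++ B := by simp
    rw [hB] at h
    have h1 : (D.machine hk hR).Run 1 (num b j)
      (contents (ParitySymbol.encodeNat (A.length + 1) ++ I) (a :: (A ++ A')) B W m [])
      (move b j) (contents (ParitySymbol.encodeNat A.length ++ I) (a :: (A ++ A')) B W m []) :=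
      .single rfl (by funext s; cases s <;> rfl)
    have h2 : (D.machine hk hR).Run 1 (move b j)
      (contents (ParitySymbol.encodeNat A.length ++ I) (a :: (A ++ A')) B W m [])
      (num b j) (contents (ParitySymbol.encodeNat A.length ++ I) (A ++ A') (a :: B) W m []) :=
      .single rfl (by funext s; cases s <;> rfl)
    exact ((h1.trans h2).trans h).mono (by simp only [List.length_cons]; omega)

theorem run_rewind (b : Bool) (j : Fin k) (I : List ParitySymbol) (A B : List (VarSymbol k))
    (W : List CVPSymbol) (m : List Unit) :
    (D.machine hk hR).Run B.length (rewind b j) (contents I A B W m [])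
      (rewind b j) (contents I (B.reverse ++ A) [] W m []) := by
  induction B generalizing A with
  | nil => exact .refl _ _ _
  | cons a B ih =>
    have h := ih (a :: A)
    have hA : B.reverse ++ a :: A = (a :: B).reverse ++ A := by simp
    rw [hA] at h
    rw [List.length_cons, add_comm]
    exact (PopMachine.Run.single rfl (by funext s; cases s <;> rfl)).trans h

/-- Reading one variable of a constraint. -/
theorem run_var (b : Bool) (j : Fin k) (I : List ParitySymbol) (A : List (VarSymbol k)) {v : ℕ}
    (hv : v < A.length) (W : List CVPSymbol) (m : List Unit) :
    (D.machine hk hR).Run (3 * A.length) (num b j)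
      (contents (ParitySymbol.encodeNat v ++ I) A [] W m [])
      (rewind b j) (contents I (A.modify v (mark j)) [] W m []) := by
  have hlen : (A.take v).length = v := List.length_take_of_le hv.le
  have hA : A = A.take v ++ A[v] :: A.drop (v + 1) := by
    rw [List.getElem_cons_drop, List.take_append_drop]
  have h1 := run_num (D := D) (hk := hk) (hR := hR) b j I (A.take v) (A[v] :: A.drop (v + 1)) [] W m
  have h2 : (D.machine hk hR).Run 1 (select b j)
      (contents I (A[v] :: A.drop (v + 1)) ((A.take v).reverse ++ []) W m []) (rewind b j)
      (contents I (mark j A[v] :: A.drop (v + 1)) ((A.take v).reverse ++ []) W m []) :=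
    .single rfl (by funext s; cases s <;> rfl)
  have h3 := run_rewind (D := D) (hk := hk) (hR := hR) b j I (mark j A[v] :: A.drop (v + 1))
    ((A.take v).reverse ++ []) W m
  rw [← hA, hlen] at h1
  have h4 : ((A.take v).reverse ++ []).reverse ++ mark j A[v] :: A.drop (v + 1) =
      A.modify v (mark j) := by
    rw [List.modify_eq_take_cons_drop hv]; simp
  rw [h4] at h3
  refine ((h1.trans h2).trans h3).mono ?_
  simp only [List.append_nil, List.length_reverse, hlen]
  omega

theorem run_pass (b : Bool) (r : Fin R) (I : List ParitySymbol) (A B : List (VarSymbol k))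
    (W : List CVPSymbol) (m : List Unit) :
    (D.machine hk hR).Run (A.length + 1) (write b r) (contents I A B W m [])
      (back b r) (contents I [] (A.reverse ++ B)
        (((A.map fun a => D.entry b r a.1).flatten ++ D.target b r).reverse ++ W) m []) := by
  induction A generalizing B W with
  | nil => exact .single rfl (by funext s; cases s <;> rfl)
  | cons a A ih =>
    have h := ih (a :: B) ((D.entry b r a.1).reverse ++ W)
    have hB : A.reverse ++ a :: B = (a :: A).reverse ++ B := by simp
    have hW : ((A.map fun a => D.entry b r a.1).flatten ++ D.target b r).reverse ++
        ((D.entry b r a.1).reverse ++ W) =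
        (((a :: A).map fun a => D.entry b r a.1).flatten ++ D.target b r).reverse ++ W := by simp
    rw [hB, hW] at h
    rw [List.length_cons, add_comm]
    exact (PopMachine.Run.single rfl (by funext s; cases s <;> rfl)).trans h

theorem run_back (b : Bool) (r : Fin R) (I : List ParitySymbol) (A B : List (VarSymbol k))
    (W : List CVPSymbol) (m : List Unit) :
    (D.machine hk hR).Run B.length (back b r) (contents I A B W m [])
      (back b r) (contents I
        ((B.map fun a => if r + 1 < R then a else clear a).reverse ++ A) [] W m []) := by
  induction B generalizing A with
  | nil => exact .refl _ _ _
  | cons a B ih =>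
    have h := ih ((if r + 1 < R then a else clear a) :: A)
    have hA : (B.map fun a => if r + 1 < R then a else clear a).reverse ++
        (if r + 1 < R then a else clear a) :: A =
        ((a :: B).map fun a => if r + 1 < R then a else clear a).reverse ++ A := by simp
    rw [hA] at h
    rw [List.length_cons, add_comm]
    exact (PopMachine.Run.single rfl (by funext s; cases s <;> rfl)).trans h

/-- The string of a row of a constraint. -/
def rowString (D : RowStrings k R) (b : Bool) (A : List (VarSymbol k)) (r : Fin R) :
    List CVPSymbol :=
  .row :: ((A.map fun a => D.entry b r a.1).flatten ++ D.target b r)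

/-- For instructions that branch on a condition, where the branch taken has to be supplied as an
equation. -/
theorem run_of_act {l l' : ReductionLabel k R} {S S' P : ∀ s : ReductionStack, List (s.Alphabet k)}
    (h : D.act hk hR l (S (src l)).head? = (some l', P))
    (hS : ∀ s, P s ++ Function.update S (src l) (S (src l)).tail s = S' s) :
    (D.machine hk hR).Run 1 l S l' S' :=
  .single (congrArg Prod.fst h) (funext fun s =>
    (congrArg (fun x => x.2 s ++ Function.update S (src l) (S (src l)).tail s) h).trans (hS s))

theorem run_row (b : Bool) (I : List ParitySymbol) (A : List (VarSymbol k)) (m : List Unit)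
    (r : Fin R) (W : List CVPSymbol) :
    (D.machine hk hR).Run (2 * A.length + 1) (write b r) (contents I A [] (.row :: W) m [])
      (back b r) (contents I (A.map fun a => if r + 1 < R then a else clear a) []
        ((D.rowString b A r).reverse ++ W) m []) := by
  have h1 := run_pass (D := D) (hk := hk) (hR := hR) b r I A [] (.row :: W) m
  have h2 := run_back (D := D) (hk := hk) (hR := hR) b r I [] (A.reverse ++ [])
    (((A.map fun a => D.entry b r a.1).flatten ++ D.target b r).reverse ++ .row :: W) m
  have h12 := h1.trans h2
  have hW : ((A.map fun a => D.entry b r a.1).flatten ++ D.target b r).reverse ++ .row :: W =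
      (D.rowString b A r).reverse ++ W := by
    simp [rowString]
  rw [hW, List.append_nil, List.append_nil, ← List.map_reverse, List.reverse_reverse,
    List.length_reverse] at h12
  exact h12.mono (by omega)

/-- Writing the rows of a constraint. -/
theorem run_rows (b : Bool) (I : List ParitySymbol) (A : List (VarSymbol k)) (m : List Unit)
    (d : ℕ) (r : Fin R) (hd : d + (r + 1) = R) (W : List CVPSymbol) :
    (D.machine hk hR).Run ((d + 1) * (2 * A.length + 2)) (write b r)
      (contents I A [] (.row :: W) m []) constr
      (contents I (A.map clear) [] (((List.ofFn (D.rowString b A)).drop r).flatten.reverse ++ W) m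
        []) := by
  have hdrop : (List.ofFn (D.rowString b A)).drop r =
      D.rowString b A r :: (List.ofFn (D.rowString b A)).drop (r + 1) := by
    rw [← List.getElem_cons_drop (by simp), List.getElem_ofFn]
  have h1 := run_row (D := D) (hk := hk) (hR := hR) b I A m r W
  rw [hdrop, List.flatten_cons, List.reverse_append, List.append_assoc]
  -- `d` is the number of rows that follow the row `r`.
  induction d generalizing r W with
  | zero =>
    have hr : ¬ (r : ℕ) + 1 < R := by omega
    have h2 : ∀ A W, (D.machine hk hR).Run 1 (back b r) (contents I A [] W m []) constr
        (contents I A [] W m []) := by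
      intro A W
      have hact : D.act hk hR (back b r) none = (some constr, contents [] [] [] [] [] []) :=
        dif_neg hr
      exact run_of_act hact (by rintro ⟨⟩ <;> rfl)
    have hnil : (List.ofFn (D.rowString b A)).drop (r + 1) = [] :=
      List.drop_eq_nil_of_le (by simp; omega)
    rw [hnil]
    simp only [hr, if_false] at h1
    exact (h1.trans (h2 _ _)).mono (by omega)
  | succ d ih =>
    have hr : (r : ℕ) + 1 < R := by omega
    have h2 : ∀ A W, (D.machine hk hR).Run 1 (back b r) (contents I A [] W m [])
        (write b ⟨r + 1, hr⟩) (contents I A [] (.row :: W) m []) := by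
      intro A W
      have hact : D.act hk hR (back b r) none =
          (some (write b ⟨r + 1, hr⟩), contents [] [] [] [.row] [] []) := dif_pos hr
      exact run_of_act hact (by rintro ⟨⟩ <;> rfl)
    have h3 := ih ⟨r + 1, hr⟩ (by simp only; omega) ((D.rowString b A r).reverse ++ W)
      (by rw [← List.getElem_cons_drop (by simpa using hr), List.getElem_ofFn])
      (run_row _ _ _ _ _ _)
    rw [← List.append_assoc, ← List.reverse_append, ← List.flatten_cons,
      ← List.getElem_ofFn (f := D.rowString b A) (i := r + 1) (by simpa using hr),
      List.getElem_cons_drop] at h3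
    simp only [hr, if_true, List.map_id'] at h1
    refine ((h1.trans (h2 _ _)).trans h3).mono ?_
    ring_nf
    omega

/-- Marking the variables of a constraint. -/
def markAll {n : ℕ} (var : Fin k → Fin n) (A : List (VarSymbol k)) (L : List (Fin k)) :
    List (VarSymbol k) :=
  L.foldl (fun A j => A.modify (var j) (mark j)) A

theorem run_vars {n : ℕ} (b : Bool) (var : Fin k → Fin n) (I : List ParitySymbol)
    (m : List Unit) (W : List CVPSymbol) (d : ℕ) (j : Fin k) (hd : d + (j + 1) = k)
    (A : List (VarSymbol k)) (hA : A.length = n) :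
    (D.machine hk hR).Run ((d + 1) * (3 * n + 1)) (num b j)
      (contents ((((List.finRange k).drop j).map fun j =>
        ParitySymbol.encodeNat (var j)).flatten ++ I) A [] W m []) (write b ⟨0, hR⟩)
      (contents I (markAll var A ((List.finRange k).drop j)) [] (.row :: W) m []) := by
  induction d generalizing j A with
  | zero =>
    have hj : ¬ (j : ℕ) + 1 < k := by omega
    have hdrop : (List.finRange k).drop j = [j] := by
      rw [← List.getElem_cons_drop (by simp), List.drop_eq_nil_of_le (by simp; omega)]
      simp
    rw [hdrop]
    have h1 := run_var (D := D) (hk := hk) (hR := hR) b j I A (v := var j) (hA ▸ (var j).2) W m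
    have h2 : ∀ A, (D.machine hk hR).Run 1 (rewind b j) (contents I A [] W m [])
        (write b ⟨0, hR⟩) (contents I A [] (.row :: W) m []) := by
      intro A
      have hact : D.act hk hR (rewind b j) none =
          (some (write b ⟨0, hR⟩), contents [] [] [] [.row] [] []) := dif_neg hj
      exact run_of_act hact (by rintro ⟨⟩ <;> rfl)
    simpa [markAll, hA] using h1.trans (h2 _)
  | succ d ih =>
    have hj : (j : ℕ) + 1 < k := by omega
    have hdrop : (List.finRange k).drop j = j :: (List.finRange k).drop (j + 1) := by
      rw [← List.getElem_cons_drop (by simp)]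
      simp
    rw [hdrop, List.map_cons, List.flatten_cons, List.append_assoc]
    have h1 := run_var (D := D) (hk := hk) (hR := hR) b j
      ((((List.finRange k).drop (j + 1)).map fun j =>
        ParitySymbol.encodeNat (var j)).flatten ++ I) A (v := var j) (hA ▸ (var j).2) W m
    have h2 : ∀ I A, (D.machine hk hR).Run 1 (rewind b j) (contents I A [] W m [])
        (num b ⟨j + 1, hj⟩) (contents I A [] W m []) := by
      intro I A
      have hact : D.act hk hR (rewind b j) none =
          (some (num b ⟨j + 1, hj⟩), contents [] [] [] [] [] []) := dif_pos hj
      exact run_of_act hact (by rintro ⟨⟩ <;> rfl)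
    have h3 := ih ⟨j + 1, hj⟩ (by simp only; omega) (A.modify (var j) (mark j)) (by simpa using hA)
    refine ((h1.trans (h2 _ _)).trans h3).mono ?_
    rw [hA]
    ring_nf
    omega

theorem modify_map_finRange {α : Type*} {n : ℕ} (f : Fin n → α) (v : Fin n) (g : α → α) :
    ((List.finRange n).map f).modify v g =
      (List.finRange n).map (Function.update f v (g (f v))) := by
  refine List.ext_getElem (by simp) fun i h1 h2 => ?_
  rw [List.getElem_modify]
  simp only [List.getElem_map, List.getElem_finRange]
  split_ifs with h
  · have : Fin.cast (List.length_finRange) ⟨i, by simpa using h1⟩ = v := Fin.ext h.symm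
    simp_all
  · rw [Function.update_of_ne]
    intro hv
    exact h (congrArg Fin.val hv).symm

theorem markAll_map_finRange {n : ℕ} (var : Fin k → Fin n) (f : Fin n → VarSymbol k)
    (L : List (Fin k)) : markAll var ((List.finRange n).map f) L = (List.finRange n).map fun v =>
      (fun j => (f v).1 j || decide (j ∈ L ∧ var j = v),
        (f v).2 || L.any fun j => decide (var j = v)) := by
  induction L generalizing f with
  | nil => simp [markAll]
  | cons j L ih =>
    rw [markAll, List.foldl_cons, ← markAll, modify_map_finRange, ih]
    refine List.map_congr_left fun v _ => ?_
    rcases eq_or_ne v (var j) with rfl | hv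
    · rw [Function.update_self]
      refine Prod.ext (funext fun i => ?_) ?_
      · rcases eq_or_ne i j with rfl | hi
        · simp [mark]
        · simp [mark, hi]
      · simp [mark]
    · rw [Function.update_of_ne hv]
      refine Prod.ext (funext fun i => ?_) ?_
      · rcases eq_or_ne i j with rfl | hi
        · simp [hv.symm]
        · simp [hi]
      · simp [hv.symm]

/-- The symbols of the variables between two constraints. -/
def usedSymbols (k : ℕ) {n : ℕ} (used : Fin n → Bool) : List (VarSymbol k) :=
  (List.finRange n).map fun v => (fun _ => false, used v)

/-- The strings of the rows of a constraint. -/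
def constraintString {n : ℕ} (D : RowStrings k R) (C : ParityConstraint k n) : List CVPSymbol :=
  (List.ofFn fun r => .row :: (((List.finRange n).map fun v =>
    D.entry C.bit r fun j => decide (C.var j = v)).flatten ++ D.target C.bit r)).flatten

theorem run_constraint {n : ℕ} (C : ParityConstraint k n) (used : Fin n → Bool)
    (I : List ParitySymbol) (m : List Unit) (W : List CVPSymbol) :
    (D.machine hk hR).Run (1 + k * (3 * n + 1) + R * (2 * n + 2)) constr
      (contents (C.encode ++ I) (usedSymbols k used) [] W m []) constr
      (contents I (usedSymbols k fun v => used v || decide (∃ j, C.var j = v)) []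
        ((D.constraintString C).reverse ++ W) (() :: m) []) := by
  set A := usedSymbols k used with hA
  have hlen : A.length = n := by simp [hA, usedSymbols]
  have h1 : (D.machine hk hR).Run 1 constr (contents (C.encode ++ I) A [] W m []) (num C.bit ⟨0, hk⟩)
      (contents ((((List.finRange k).drop 0).map fun j =>
        ParitySymbol.encodeNat (C.var j)).flatten ++ I) A [] W (() :: m) []) := by
    rw [List.drop_zero, ParityConstraint.encode, List.ofFn_eq_map, ParityConstraint.bit]
    by_cases hr : C.rhs = 0
    · rw [if_pos hr, decide_eq_true hr]
      exact .single rfl (by funext s; cases s <;> rfl)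
    · rw [if_neg hr, decide_eq_false hr]
      exact .single rfl (by funext s; cases s <;> rfl)
  have h2 := run_vars (D := D) (hk := hk) (hR := hR) C.bit C.var I (() :: m) W (k - 1) ⟨0, hk⟩
    (by simp only; omega) A hlen
  have hmark : markAll C.var A ((List.finRange k).drop 0) = (List.finRange n).map fun v =>
      (fun j => decide (C.var j = v), used v || decide (∃ j, C.var j = v)) := by
    rw [hA, usedSymbols, markAll_map_finRange]
    refine List.map_congr_left fun v _ => Prod.ext (funext fun j => ?_) ?_
    · simp
    · simp only [List.drop_zero]
      congr 1
      rw [Bool.eq_iff_iff]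
      simp
  have h3 := run_rows (D := D) (hk := hk) (hR := hR) C.bit I
    (markAll C.var A ((List.finRange k).drop 0)) (() :: m) (R - 1) ⟨0, hR⟩ (by simp only; omega) W
  have hclear : (markAll C.var A ((List.finRange k).drop 0)).map clear =
      usedSymbols k fun v => used v || decide (∃ j, C.var j = v) := by
    rw [hmark, List.map_map]
    rfl
  have hrows : ((List.ofFn (D.rowString C.bit (markAll C.var A ((List.finRange k).drop 0)))).drop
      0).flatten = D.constraintString C := by
    rw [hmark, List.drop_zero, constraintString]
    congr 2
    funext r
    rw [rowString, List.map_map]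
    rfl
  simp only at h3
  rw [hclear, hrows] at h3
  refine ((h1.trans h2).trans h3).mono ?_
  have hml : (markAll C.var A ((List.finRange k).drop 0)).length = n := by rw [hmark]; simp
  rw [hml, show k - 1 + 1 = k by omega, show R - 1 + 1 = R by omega]

theorem run_constraints {n : ℕ} (L : List (ParityConstraint k n)) (used : Fin n → Bool)
    (m : List Unit) (W : List CVPSymbol) :
    (D.machine hk hR).Run (L.length * (1 + k * (3 * n + 1) + R * (2 * n + 2))) constr
      (contents (L.map ParityConstraint.encode).flatten (usedSymbols k used) [] W m []) constr
      (contents [] (usedSymbols k fun v => used v || occurs L v) []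
        ((L.map D.constraintString).flatten.reverse ++ W) (List.replicate L.length () ++ m) []) := by
  induction L generalizing used m W with
  | nil => simpa [occurs] using PopMachine.Run.refl _ _ _
  | cons C L ih =>
    have h1 := run_constraint (D := D) (hk := hk) (hR := hR) C used
      (L.map ParityConstraint.encode).flatten m W
    have h2 := ih (fun v => used v || decide (∃ j, C.var j = v)) (() :: m)
      ((D.constraintString C).reverse ++ W)
    rw [replicate_append_cons, ← List.append_assoc, ← List.reverse_append, ← List.flatten_cons] at h2
    simp only [Bool.or_assoc] at h2
    refine (h1.trans h2).mono ?_
    rw [List.length_cons]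
    ring_nf
    omega

end RowStrings

/-! ### Runs of the machine on the remaining rows and the radius. -/

/-- A row as a string. -/
def CVPRow.encode {n : ℕ} (r : CVPRow n) : List CVPSymbol :=
  .row :: (((List.finRange n).map fun j => (r.1 j).encode).flatten ++ r.2.encode)

theorem flatten_map_encode_nat {α : Type*} (e : α → RealExpr) (L : List α)
    (h : ∀ a ∈ L, e a = .nat 0) :
    (L.map fun a => (e a).encode).flatten = List.replicate L.length .close := by
  induction L with
  | nil => rfl
  | cons a L ih =>
    rw [List.map_cons, List.flatten_cons, ih fun x hx => h x (List.mem_cons_of_mem _ hx),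
      h a List.mem_cons_self]
    rfl

/-- The literal `0` is the string `close`; splitting the variables at `v` gives the shape in which
the scan produces the row. -/
theorem encode_unitRow {n : ℕ} {v : Fin n} {L₁ L₂ : List (Fin n)}
    (h : List.finRange n = L₁ ++ v :: L₂) :
    CVPRow.encode (unitRow v) = .row :: (List.replicate L₁.length .close ++
      .tick :: .close :: (List.replicate L₂.length .close ++ [.close])) := by
  have hn := List.nodup_finRange n
  rw [h, List.nodup_middle, List.nodup_cons, List.mem_append, not_or] at hn
  rw [CVPRow.encode, h, List.map_append, List.map_cons, List.flatten_append, List.flatten_cons,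
    flatten_map_encode_nat (unitRow v).1 L₁ fun a ha => if_neg fun h' : a = v => hn.1.1 (h' ▸ ha),
    flatten_map_encode_nat (unitRow v).1 L₂ fun a ha => if_neg fun h' : a = v => hn.1.2 (h' ▸ ha)]
  simp [unitRow, RealExpr.encode, CVPSymbol.encodeNat]

theorem encode_zeroRow (n : ℕ) :
    CVPRow.encode (zeroRow n) = .row :: (List.replicate n .close ++ [.close]) := by
  rw [CVPRow.encode, flatten_map_encode_nat (zeroRow n).1 _ fun _ _ => rfl, List.length_finRange]
  rfl

namespace RowStrings

open ReductionStack ReductionLabel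

variable {k R : ℕ} {D : RowStrings k R} {hk : 0 < k} {hR : 0 < R}

theorem run_scan (f : Bool) (I : List ParitySymbol) (A A' B : List (VarSymbol k))
    (hA : ∀ a ∈ A, (f || a.2) = true) (W : List CVPSymbol) (m : List Unit) :
    (D.machine hk hR).Run A.length (unitPass f) (contents I (A ++ A') B W m [])
      (unitPass f) (contents I A' (A.reverse ++ B) (List.replicate A.length .close ++ W) m []) := by
  induction A generalizing B W with
  | nil => exact .refl _ _ _
  | cons a A ih =>
    have h := ih (a :: B) (fun x hx => hA x (List.mem_cons_of_mem _ hx)) (.close :: W)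
    rw [replicate_append_cons] at h
    have hact : D.act hk hR (unitPass f) (some a) =
        (some (unitPass f), contents [] [] [a] [.close] [] []) := if_pos (hA a List.mem_cons_self)
    rw [List.reverse_cons, List.append_assoc, List.length_cons, Nat.add_comm A.length]
    rw [Nat.add_comm] at h
    exact (run_of_act hact (by rintro ⟨⟩ <;> rfl)).trans (h.mono (by omega))

theorem run_unitBack (I : List ParitySymbol) (A B : List (VarSymbol k))
    (W : List CVPSymbol) (m : List Unit) :
    (D.machine hk hR).Run (B.length + 1) (unitBack true) (contents I A B W m [])
      (unitPass false) (contents I (B.reverse ++ A) [] (.row :: W) m []) := by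
  induction B generalizing A with
  | nil => exact .single rfl (by funext s; cases s <;> rfl)
  | cons b B ih =>
    have h := ih (b :: A)
    rw [List.reverse_cons, List.append_assoc, List.length_cons, Nat.add_right_comm, Nat.add_comm]
    exact (PopMachine.Run.single rfl (by funext s; cases s <;> rfl)).trans h

theorem run_discard (I : List ParitySymbol) (A B : List (VarSymbol k))
    (W : List CVPSymbol) (m : List Unit) :
    (D.machine hk hR).Run (B.length + 1) (unitBack false) (contents I A B W m [])
      radius (contents I A [] (D.before.reverse ++ W) m []) := by
  induction B with
  | nil => exact .single rfl (by funext s; cases s <;> rfl)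
  | cons b B ih =>
    rw [List.length_cons, Nat.add_right_comm, Nat.add_comm]
    exact (PopMachine.Run.single rfl (by funext s; cases s <;> rfl)).trans ih

/-- Writing the row of the first unmarked variable. -/
theorem run_unitRow {n : ℕ} {v : Fin n} {l : List (Fin n)} {used : Fin n → Bool}
    (hl : unmarked used = v :: l) (W : List CVPSymbol) (m : List Unit) :
    unmarked (Function.update used v true) = l ∧
    (D.machine hk hR).Run (2 * n + 2) (unitPass false)
      (contents [] (usedSymbols k used) [] (.row :: W) m []) (unitPass false)
      (contents [] (usedSymbols k (Function.update used v true)) []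
        (.row :: ((CVPRow.encode (unitRow v)).reverse ++ W)) m []) := by
  obtain ⟨L₁, L₂, hL, hL₁, hv, rfl⟩ := List.filter_eq_cons_iff.1 hl
  have hn := List.nodup_finRange n
  rw [hL, List.nodup_middle, List.nodup_cons, List.mem_append, not_or] at hn
  have hup : ∀ w, w ≠ v → Function.update used v true w = used w := fun w hw =>
    Function.update_of_ne hw _ _
  have hne₁ : ∀ w ∈ L₁, w ≠ v := fun w hw h => hn.1.1 (h ▸ hw)
  have hne₂ : ∀ w ∈ L₂, w ≠ v := fun w hw h => hn.1.2 (h ▸ hw)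
  have hlen : n = L₁.length + (L₂.length + 1) := by
    simpa using congrArg List.length hL
  constructor
  · rw [unmarked, hL, List.filter_append, List.filter_cons_of_neg (by simp),
      List.filter_eq_nil_iff.2 fun w hw => by rw [hup w (hne₁ w hw)]; exact hL₁ w hw]
    exact List.filter_congr fun w hw => by rw [hup w (hne₂ w hw)]
  · let sym : Fin n → VarSymbol k := fun w => (fun _ => false, used w)
    have hA : usedSymbols k used = L₁.map sym ++ sym v :: L₂.map sym := by
      rw [usedSymbols, hL, List.map_append, List.map_cons]
    have hA' : usedSymbols k (Function.update used v true) =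
        L₁.map sym ++ (fun _ => false, true) :: L₂.map sym := by
      rw [usedSymbols, hL, List.map_append, List.map_cons, Function.update_self]
      congr 1
      · exact List.map_congr_left fun w hw => by rw [hup w (hne₁ w hw)]
      · congr 1
        exact List.map_congr_left fun w hw => by rw [hup w (hne₂ w hw)]
    have h1 := run_scan (D := D) (hk := hk) (hR := hR) false [] (L₁.map sym)
      (sym v :: L₂.map sym) [] (by simpa [sym] using hL₁) (.row :: W) m
    have hact : D.act hk hR (unitPass false) (some (sym v)) =
        (some (unitPass true), contents [] [] [(fun _ => false, true)] [.close, .tick] [] []) :=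
      if_neg (by simpa [sym] using hv)
    have h2 : ∀ A B W, (D.machine hk hR).Run 1 (unitPass false) (contents [] (sym v :: A) B W m [])
        (unitPass true)
        (contents [] A ((fun _ => false, true) :: B) (.close :: .tick :: W) m []) := fun A B W =>
      run_of_act hact (by rintro ⟨⟩ <;> rfl)
    have h3 := run_scan (D := D) (hk := hk) (hR := hR) true [] (L₂.map sym) []
      ((fun _ => false, true) :: ((L₁.map sym).reverse ++ [])) (by simp)
      (.close :: .tick :: (List.replicate (L₁.map sym).length .close ++ .row :: W)) m
    have h4 : ∀ B W, (D.machine hk hR).Run 1 (unitPass true) (contents [] [] B W m [])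
        (unitBack true) (contents [] [] B (.close :: W) m []) := fun B W =>
      .single rfl (by funext s; cases s <;> rfl)
    have h5 := run_unitBack (D := D) (hk := hk) (hR := hR) [] []
      ((L₂.map sym).reverse ++ (fun _ => false, true) :: ((L₁.map sym).reverse ++ []))
      (.close :: (List.replicate (L₂.map sym).length .close ++ .close :: .tick ::
        (List.replicate (L₁.map sym).length .close ++ .row :: W))) m
    rw [List.append_nil] at h3
    have h := (((h1.trans (h2 _ _ _)).trans h3).trans (h4 _ _)).trans h5
    rw [← hA] at h
    have hleft : ((L₂.map sym).reverse ++
        (fun _ => false, true) :: ((L₁.map sym).reverse ++ [])).reverse ++ [] =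
        usedSymbols k (Function.update used v true) := by
      rw [hA']; simp
    have hW : CVPSymbol.close :: (List.replicate (L₂.map sym).length .close ++ .close :: .tick ::
        (List.replicate (L₁.map sym).length .close ++ .row :: W)) =
        (CVPRow.encode (unitRow v)).reverse ++ W := by
      rw [encode_unitRow hL]; simp
    rw [hleft, hW] at h
    refine h.mono ?_
    simp only [List.length_append, List.length_reverse, List.length_cons, List.length_map,
      List.length_nil]
    omega

/-- Writing the row of zeros. -/
theorem run_zeroRow {n : ℕ} {used : Fin n → Bool} (hl : unmarked used = []) (W : List CVPSymbol)
    (m : List Unit) :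
    (D.machine hk hR).Run (2 * n + 2) (unitPass false)
      (contents [] (usedSymbols k used) [] (.row :: W) m []) radius
      (contents [] [] [] (D.before.reverse ++ ((CVPRow.encode (zeroRow n)).reverse ++ W)) m
        []) := by
  have hlen : (usedSymbols k used).length = n := by simp [usedSymbols]
  have h1 := run_scan (D := D) (hk := hk) (hR := hR) false [] (usedSymbols k used) [] []
    (by simpa [usedSymbols, unmarked] using hl) (.row :: W) m
  have h2 : ∀ B W, (D.machine hk hR).Run 1 (unitPass false) (contents [] [] B W m [])
      (unitBack false) (contents [] [] B (.close :: W) m []) := fun B W =>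
    .single rfl (by funext s; cases s <;> rfl)
  have h3 := run_discard (D := D) (hk := hk) (hR := hR) [] [] ((usedSymbols k used).reverse ++ [])
    (.close :: (List.replicate (usedSymbols k used).length .close ++ .row :: W)) m
  have h := (h1.trans (h2 _ _)).trans h3
  have hW : CVPSymbol.close :: (List.replicate (usedSymbols k used).length .close ++ .row :: W) =
      (CVPRow.encode (zeroRow n)).reverse ++ W := by
    rw [encode_zeroRow, hlen]; simp
  rw [hW, List.append_nil, List.append_nil] at h
  refine h.mono ?_
  rw [List.length_reverse, hlen]
  omega

/-- Writing the rows that do not belong to constraints. -/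
theorem run_unitRows {n : ℕ} (l : List (Fin n)) {used : Fin n → Bool} (hl : unmarked used = l)
    (W : List CVPSymbol) (m : List Unit) :
    (D.machine hk hR).Run ((l.length + 1) * (2 * n + 2)) (unitPass false)
      (contents [] (usedSymbols k used) [] (.row :: W) m []) radius
      (contents [] [] [] (D.before.reverse ++
        (((l.map unitRow ++ [zeroRow n]).map CVPRow.encode).flatten.reverse ++ W)) m []) := by
  induction l generalizing used W with
  | nil => simpa using run_zeroRow hl W m
  | cons v l ih =>
    obtain ⟨hl', h1⟩ := run_unitRow (D := D) (hk := hk) (hR := hR) hl W m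
    have h2 := ih hl' ((CVPRow.encode (unitRow v)).reverse ++ W)
    have hW : ((((v :: l).map unitRow ++ [zeroRow n]).map CVPRow.encode).flatten.reverse ++ W) =
        ((l.map unitRow ++ [zeroRow n]).map CVPRow.encode).flatten.reverse ++
          ((CVPRow.encode (unitRow v)).reverse ++ W) := by
      rw [← List.append_assoc, ← List.reverse_append]
      rfl
    rw [hW]
    refine (h1.trans h2).mono ?_
    rw [List.length_cons]
    ring_nf
    omega

theorem run_radius (W : List CVPSymbol) (m : ℕ) :
    (D.machine hk hR).Run (m + 1) radius (contents [] [] [] W (List.replicate m ()) []) pour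
      (contents [] [] [] (D.after.reverse ++ (List.replicate m .tick ++ W)) [] []) := by
  induction m generalizing W with
  | zero => exact .single rfl (by funext s; cases s <;> rfl)
  | succ m ih =>
    have h := ih (.tick :: W)
    rw [replicate_append_cons] at h
    rw [Nat.add_comm]
    exact (PopMachine.Run.single rfl (by funext s; cases s <;> rfl)).trans h

theorem run_pour (W o : List CVPSymbol) :
    (D.machine hk hR).Run W.length pour (contents [] [] [] W [] o) pour
      (contents [] [] [] [] [] (W.reverse ++ o)) := by
  induction W generalizing o with
  | nil => exact .refl _ _ _
  | cons x W ih =>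
    rw [List.reverse_cons, List.append_assoc, List.length_cons, Nat.add_comm]
    exact (PopMachine.Run.single rfl (by funext s; cases s <;> rfl)).trans (ih (x :: o))

/-- The string that the machine writes. -/
def outputString (D : RowStrings k R) {n : ℕ} (L : List (ParityConstraint k n)) : List CVPSymbol :=
  CVPSymbol.encodeNat n ++ ((L.map D.constraintString).flatten ++
    ((((unmarked (occurs L)).map unitRow ++ [zeroRow n]).map CVPRow.encode).flatten ++
      (D.before ++ (List.replicate L.length .tick ++ D.after))))

theorem run_until_pour {n : ℕ} (L : List (ParityConstraint k n)) :
    (D.machine hk hR).Run (n + 1 + L.length * (1 + k * (3 * n + 1) + R * (2 * n + 2)) + 1 +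
        (n + 1) * (2 * n + 2) + (L.length + 1)) init
      (contents (ParitySymbol.encodeNat n ++ (L.map ParityConstraint.encode).flatten) [] [] [] []
        []) pour (contents [] [] [] (D.outputString L).reverse [] []) := by
  have h1 := run_init (D := D) (hk := hk) (hR := hR) n (L.map ParityConstraint.encode).flatten [] []
  have hrep : List.replicate n ((fun _ => false, false) : VarSymbol k) ++ [] =
      usedSymbols k fun _ : Fin n => false := by
    rw [usedSymbols, List.map_const', List.length_finRange, List.append_nil]
  rw [hrep] at h1
  have h2 := run_constraints (D := D) (hk := hk) (hR := hR) L (fun _ => false) []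
    ((CVPSymbol.encodeNat n).reverse ++ [])
  simp only [Bool.false_or, List.append_nil] at h1 h2
  have h3 : ∀ A W m, (D.machine hk hR).Run 1 constr (contents [] A [] W m []) (unitPass false)
      (contents [] A [] (.row :: W) m []) := fun A W m =>
    .single rfl (by funext s; cases s <;> rfl)
  have h4 := run_unitRows (D := D) (hk := hk) (hR := hR) _ (rfl : unmarked (occurs L) = _)
    ((L.map D.constraintString).flatten.reverse ++ (CVPSymbol.encodeNat n).reverse)
    (List.replicate L.length ())
  have h5 := run_radius (D := D) (hk := hk) (hR := hR) (D.before.reverse ++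
    ((((unmarked (occurs L)).map unitRow ++ [zeroRow n]).map CVPRow.encode).flatten.reverse ++
      ((L.map D.constraintString).flatten.reverse ++ (CVPSymbol.encodeNat n).reverse))) L.length
  have h := (((h1.trans h2).trans (h3 _ _ _)).trans h4).trans h5
  have hout : (D.outputString L).reverse = D.after.reverse ++ (List.replicate L.length .tick ++
      (D.before.reverse ++
      ((((unmarked (occurs L)).map unitRow ++ [zeroRow n]).map CVPRow.encode).flatten.reverse ++
      ((L.map D.constraintString).flatten.reverse ++ (CVPSymbol.encodeNat n).reverse)))) := by
    simp only [outputString, List.reverse_append, List.reverse_replicate, List.append_assoc]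
  rw [hout]
  refine h.mono ?_
  have hlen : (unmarked (occurs L)).length ≤ n :=
    (List.length_filter_le _ _).trans_eq List.length_finRange
  gcongr

end RowStrings

/-! ### Polynomial running time. -/

theorem nonempty_computableInPolyTime {α β : Type} (tm : Turing.FinTM2)
    {ea : α → List (tm.Γ tm.k₀)} {eb : β → List (tm.Γ tm.k₁)} {f : α → β} (T : Polynomial ℕ)
    (h : ∀ a, Nonempty (Turing.TM2OutputsInTime tm (ea a) (some (eb (f a)))
      (T.eval (ea a).length))) :
    Nonempty (Turing.TM2ComputableInPolyTime ea eb f) := by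
  refine ⟨⟨⟨tm, Equiv.refl _, Equiv.refl _⟩, T, fun a => ?_⟩⟩
  have hmap : ∀ {α : Type} (L : List α), L.map (Equiv.refl α).invFun = L := fun L => List.map_id L
  rw [hmap, hmap]
  exact Classical.choice (h a)

theorem PopMachine.Run.outputsInTime {K : Type} {Γ : K → Type} {Λ : Type} [DecidableEq K]
    [Fintype K] [Fintype Λ] [∀ k, Fintype (Γ k)] {M : PopMachine K Γ Λ} {k₀ k₁ : K} {t : ℕ}
    {l l' : Λ} {S S' : ∀ k, List (Γ k)} {w : List (Γ k₀)} {w' : List (Γ k₁)}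
    (h : M.Run t l S l' S') (hhalt : M.next l' (S' (M.src l')).head? = none)
    (hS : S = Function.update (fun _ => []) k₀ w)
    (hS' : M.push l' S' = Function.update (fun _ => []) k₁ w') :
    Nonempty (Turing.TM2OutputsInTime (M.toFinTM2 l k₀ k₁) w (some w') (2 * (t + 1))) := by
  obtain ⟨e⟩ := h.evalsTo (main := l) (k₀ := k₀) (k₁ := k₁) hhalt
  rw [hS'] at e
  subst hS
  refine ⟨⟨⟨e.steps, ?_⟩, e.steps_le_m⟩⟩
  exact (congrArg (fun C => (flip bind (M.toFinTM2 l k₀ k₁).step)^[e.steps] (some C))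
    (initList_toFinTM2 l k₀ k₁ w)).trans
    (e.evals_in_steps.trans (congrArg some (haltList_toFinTM2 l k₀ k₁ w').symm))

namespace RowStrings

open ReductionStack ReductionLabel

variable {k R : ℕ} {D : RowStrings k R} {hk : 0 < k} {hR : 0 < R}

/-- A bound for the number of steps, for an input of the length `L`, that the machine needs before
it copies its output. -/
def timeBound (k R L : ℕ) : ℕ :=
  L + 1 + L * (1 + k * (3 * L + 1) + R * (2 * L + 2)) + 1 + (L + 1) * (2 * L + 2) + (L + 1)

theorem run_toFinTM2 (Φ : ParityInstance k) {c : ℕ}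
    (hc : ∀ l o s, ((D.machine hk hR).out l o s).length ≤ c) :
    Nonempty (Turing.TM2OutputsInTime ((D.machine hk hR).toFinTM2 init inp res)
      Φ.encode (some (D.outputString Φ.constraints))
      (2 * ((1 + c) * timeBound k R Φ.encode.length + 1))) := by
  have hlen : Φ.encode.length = Φ.numVars + 1 +
      (Φ.constraints.map fun C => C.encode.length).sum := by
    simp [ParityInstance.encode, ParitySymbol.encodeNat, List.length_flatten, Function.comp_def]
    omega
  have hsum : Φ.constraints.length ≤ (Φ.constraints.map fun C => C.encode.length).sum := by
    have h := List.card_nsmul_le_sum (Φ.constraints.map fun C => C.encode.length) 1 (by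
      intro x hx
      obtain ⟨C, -, rfl⟩ := List.mem_map.1 hx
      simp [ParityConstraint.encode])
    simpa using h
  have h1 := (run_until_pour (D := D) (hk := hk) (hR := hR) Φ.constraints).mono
    (t' := timeBound k R Φ.encode.length) (by
      have hn : Φ.numVars ≤ Φ.encode.length := by omega
      have hm : Φ.constraints.length ≤ Φ.encode.length := by omega
      unfold timeBound
      gcongr)
  -- At most `c` symbols are written per step, and pouring takes one step per symbol, whence the
  -- factor `1 + c` in the total time.
  have hout : (D.outputString Φ.constraints).length ≤ c * timeBound k R Φ.encode.length := by
    have h := h1.length_le hc work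
    rwa [show (contents [] [] [] (D.outputString Φ.constraints).reverse [] [] work).length =
      (D.outputString Φ.constraints).length from List.length_reverse,
      show (contents (k := k) (ParitySymbol.encodeNat Φ.numVars ++
        (Φ.constraints.map ParityConstraint.encode).flatten) [] [] [] [] [] work).length = 0 from rfl,
      Nat.zero_add] at h
  have h2 := h1.trans (run_pour (D := D) (hk := hk) (hR := hR)
    (D.outputString Φ.constraints).reverse [])
  rw [List.reverse_reverse, List.append_nil, List.length_reverse] at h2
  refine (h2.mono (t' := (1 + c) * timeBound k R Φ.encode.length) (by
    rw [add_mul, one_mul]; omega)).outputsInTime rfl ?_ ?_ <;> funext s <;> cases s <;> rfl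

open Polynomial in
theorem computableInPolyTime {f : ParityInstance k → CVPInstance} (hk : 0 < k) (hR : 0 < R)
    (hf : ∀ Φ, (f Φ).encode = D.outputString Φ.constraints) :
    Nonempty (Turing.TM2ComputableInPolyTime ParityInstance.encode CVPInstance.encode f) := by
  obtain ⟨c, hc⟩ := (D.machine hk hR).exists_length_out_le
  let T : ℕ[X] := 2 * ((1 + (c : ℕ[X])) * (X + 1 + X * (1 + (k : ℕ[X]) * (3 * X + 1) +
    (R : ℕ[X]) * (2 * X + 2)) + 1 + (X + 1) * (2 * X + 2) + (X + 1)) + 1)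
  have hT : ∀ L, T.eval L = 2 * ((1 + c) * timeBound k R L + 1) := fun L => by
    simp [T, timeBound]
  refine nonempty_computableInPolyTime ((D.machine hk hR).toFinTM2 init inp res)
    (ea := ParityInstance.encode) (eb := CVPInstance.encode) T fun Φ => ?_
  have h := run_toFinTM2 (D := D) (hk := hk) (hR := hR) Φ hc
  rw [← hf, ← hT] at h
  exact h

end RowStrings

/-! ### The machine's output is the instance; conclusion. -/

/-- The strings of the reduction. -/
noncomputable def reductionStrings (p : ℝ) (k : ℕ) : RowStrings k (signCount (slotCount k)) where
  entry b r J := (entryExpr (rowParity p k b) (signVector _ r) J).encode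
  target b r := (targetExpr (rowParity p k b) (signVector _ r)).encode
  -- The radius is cut at the ticks of the literal `m`, its only part that varies with the instance.
  before := [.pow, .mul]
  after := .close :: ((meanCostExpr p (slotCount k)).encode ++
    (RealExpr.div (.nat 1) (.param 0)).encode)

theorem CVPInstance.encode_ofRows {n : ℕ} (rows : List (CVPRow n)) (r : RealExpr) :
    (CVPInstance.ofRows rows r).encode =
      CVPSymbol.encodeNat n ++ (rows.map CVPRow.encode).flatten ++ r.encode := by
  have h : (List.ofFn fun i => CVPRow.encode (rows.get i)) = rows.map CVPRow.encode := by
    conv_rhs => rw [← List.ofFn_get rows, List.map_ofFn]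
    rfl
  rw [← h]
  simp only [CVPRow.encode, ← List.ofFn_eq_map]
  rfl

theorem ParityConstraint.flatten_map_encode_rows (p : ℝ) {k n : ℕ} (C : ParityConstraint k n) :
    ((C.rows p).map CVPRow.encode).flatten = (reductionStrings p k).constraintString C := by
  rw [ParityConstraint.rows, List.map_ofFn]
  rfl

theorem ParityInstance.encode_toCVP (p : ℝ) {k : ℕ} (Φ : ParityInstance k) :
    (Φ.toCVP p).encode = (reductionStrings p k).outputString Φ.constraints := by
  have h : (((Φ.constraints.map (ParityConstraint.rows p)).flatten).map CVPRow.encode).flatten =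
      (Φ.constraints.map (reductionStrings p k).constraintString).flatten := by
    rw [List.map_flatten, List.flatten_flatten, List.map_map, List.map_map]
    exact congrArg _ (List.map_congr_left fun C _ => C.flatten_map_encode_rows p)
  rw [ParityInstance.toCVP, CVPInstance.encode_ofRows, ParityInstance.rows, List.map_append,
    List.flatten_append, h]
  simp [RowStrings.outputString, radiusExpr, RealExpr.encode, reductionStrings,
    CVPSymbol.encodeNat]

theorem ParityInstance.computableInPolyTime_toCVP (p : ℝ) {k : ℕ} (hk : 0 < k) :
    Nonempty (Turing.TM2ComputableInPolyTime ParityInstance.encode CVPInstance.encode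
      (ParityInstance.toCVP p (k := k))) :=
  RowStrings.computableInPolyTime hk Fintype.card_pos (ParityInstance.encode_toCVP p)

theorem mainTheorem3 (p : ℝ) (hp : 1 ≤ p) (hp_even : ∀ z : ℤ, p ≠ 2 * (z : ℝ))
    (k : ℕ) (hk : max 2 p < (k : ℝ)) (s c : ℝ) (hs : 1 / 2 < s) (hsc : s ≤ c) (hc : c < 1) :
    ∃ γ : ℝ,
      1 + (c - s) * (|Real.sin (Real.pi * p / 2)| / (4 * p ^ 3 * (k : ℝ))) *
          (2 * p / (Real.exp 1 ^ 2 * Real.pi ^ 2 * (k : ℝ))) ^ ((p + 1) / 2) ≤ γ ∧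
      ∃ (f : ParityInstance k → CVPInstance) (N : ℕ),
        IsPolyTimeKarpReduction ParityInstance.encode CVPInstance.encode
          (GapParity k s c) (GapCVP ![p, s, c] p γ) f ∧
        ∀ Φ : ParityInstance k,
          (f Φ).rank = Φ.numVars ∧
          (f Φ).IsValid ![p, s, c] ∧
          (f Φ).AllExpr (fun x => x.numOps ≤ N) := by
  obtain ⟨hk2, hkp⟩ := max_lt_iff.1 hk
  -- Three slots are needed for the independence of the columns.
  have hk3 : 3 ≤ k := by exact_mod_cast hk2
  have hlow : lowCost p (slotCount k) < highCost p (slotCount k) := by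
    refine lowCost_lt_highCost (by linarith) hp_even (hkp.trans_le ?_)
    exact_mod_cast le_slotCount k
  exact ⟨cvpGap p k s c, le_cvpGap hp hp_even hk hs hsc hc, ParityInstance.toCVP p,
    (radiusExpr p k 0).numOps,
    ⟨ParityInstance.computableInPolyTime_toCVP p (by omega),
      fun Φ h => Φ.toCVP_mem_yes hp hk3 hlow (by linarith) hc _ h,
      fun Φ h => Φ.toCVP_mem_no hp hk3 hlow (by linarith) hsc hc h⟩,
    fun Φ => ⟨rfl, Φ.isValid_toCVP hp hk3 s hlow (by linarith) hc, Φ.allExpr_numOps_le p⟩⟩
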